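/- **Setting.** Let $A\in\mathbb R^{n\times n}$ be symmetric with zero diagonal and $\theta\in\mathbb R^n$. The Ising model $\mathcal D(A,\theta)$ is the distribution on $\{-1,1\}^n$ with $\Pr[Z=z]\propto\exp\big(\sum_{i<j}A_{ij}z_iz_j+\sum_i\theta_iz_i\big)$. Let $\lambda\ge\max_i\big(\sum_j|A_{ij}|+|\theta_i|\big)$. For known $p_1,\dots,p_n\in[0,1)$, a sample $X\sim\mathcal D_{\mathsf{miss}}$ with missing data is obtained by drawing $Z\sim\mathcal D(A,\theta)$ and, independently for each $i$, putting $X_i=0$ (missing) with probability $p_i$ and $X_i=Z_i$ otherwise. Let $p_{\max}<1$ be a bound with $p_i\le p_{\max}$ for all $i$. Fix a vertex, without loss of generality the vertex $n$ (the same statement holds for every vertex). For $v\in\mathbb R^n$ let $S(v)=\mathbb E_{Z\sim\mathcal D(A,\theta)}\big[\exp\big(-\sum_{j=1}^{n-1}v_jZ_nZ_j-v_nZ_n\big)\big]$ be the modified interaction screening objective, and let $v^*=(A_{n1},\dots,A_{n,n-1},\theta_n)$. Let $\Delta(\lambda,2n+1)=\{w\in\mathbb R^{2n+1}:w\ge0,\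 \sum_kw_k=\lambda\}$, and for $w\in\mathbb R^{2n+1}$ let $\Pi(w)=(w_i-w_{n+i})_{i=1}^n$ and $\widetilde S(w)=S(\Pi(w))$. With $v=\Pi(w)$ put, for $i\le n-1$, $$g^i(w;X)=-\frac{e^{-v_nX_n}X_n}{1-p_n}\cdot\frac{e^{-v_iX_nX_i}X_i}{1-p_i}\prod_{j\ne i,n}\frac{e^{-v_jX_nX_j}-p_j}{1-p_j},\qquad g^n(w;X)=-\frac{e^{-v_nX_n}X_n}{1-p_n}\prod_{j\ne n}\frac{e^{-v_jX_nX_j}-p_j}{1-p_j},$$ and $G(w;X)=\sum_{i=1}^ng^i(w;X)(e^i-e^{n+i})\in\mathbb R^{2n+1}$. The algorithm with step size $\eta$ starts from $w^1_k=\lambda/(2n+1)$ for all $k$. For $t=1,\dots,T$ it takes a fresh independent sample $X^t\sim\mathcal D_{\mathsf{miss}}$ and sets $w^{t+1}_k=w^t_k\big(1-\eta\,G(w^t;X^t)_k+\eta\,C^t\big)$ with $C^t=\langle w^t,G(w^t;X^t)\rangle/\lambda$. It returns $\bar w=\frac1T\sum_{t=1}^Tw^t$. **Theorem.** 1. (Restricted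 strong convexity.) For all $v\in\mathbb R^n$ with $\|v\|_1\le\lambda$, $$S(v)-S(v^*)\ \ge\ \nabla S(v^*)^{T}(v-v^*)+\frac{e^{-3\lambda}}{2(1+\lambda)}\max_{i\le n-1}|v_i-A_{ni}|^2 .$$ 2. (Unbiased bounded estimator.) $\mathbb E_{X\sim\mathcal D_{\mathsf{miss}}}[G(w;X)]=\nabla\widetilde S(w)$ for every $w\in\mathbb R^{2n+1}$, and $\|G(w;X)\|_\infty\le\frac1{(1-p_{\max})^2}\exp\big(\frac{\lambda}{1-p_{\max}}\big)$ for all $w\in\Delta(\lambda,2n+1)$ and $X\in\{-1,0,1\}^n$. 3. (Recovery.) For every $p_{\max}<1$ and $\lambda_0>0$ there is a constant $C>0$, depending only on $p_{\max}$ and $\lambda_0$, such that the following holds for all $n$, all $p_1,\dots,p_n\in[0,p_{\max}]$, all $\lambda\ge\lambda_0$ and all $T$. There is a step size $\eta>0$, which does not depend on the unknown model $(A,\theta)$, nor on $\epsilon$ and $\delta$, such that for every Ising model $\mathcal D(A,\theta)$ of width at most $\lambda$, every $\epsilon>0$ and every $\delta\in(0,1)$ with $$T\ \ge\ \lambda^4\log(n/\delta)\,\exp(C\lambda)\,\epsilon^{-4},$$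 with probability at least $1-\delta$ the output of the algorithm satisfies $|\Pi(\bar w)_i-A_{ni}|\le\epsilon$ for all $i\in[n-1]$. -/

import Mathlib

open MeasureTheory ProbabilityTheory

namespace MissingIsing

noncomputable section

instance : DiscreteMeasurableSpace ℤˣ where
  forall_measurableSet s := by
    refine ⟨(fun z : ℤˣ => (z : ℤ)) '' s, MeasurableSet.of_discrete, ?_⟩
    exact Set.preimage_image_eq s Units.val_injective

/-- The exponent of the Ising model `D(A, θ)` at the spin configuration `z ∈ {-1, 1}ⁿ`; each
unordered pair `{i, j}` is counted once (pairs that are not edges have `A i j = 0`). -/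
def energy {n : ℕ} (A : Matrix (Fin n) (Fin n) ℝ) (θ : Fin n → ℝ) (z : Fin n → ℤˣ) : ℝ :=
  ∑ i, ∑ j ∈ Finset.Ioi i, A i j * ((z i : ℤ) : ℝ) * ((z j : ℤ) : ℝ) + ∑ i, θ i * ((z i : ℤ) : ℝ)

/-- The Ising model `D(A, θ)`: the probability of `z` is proportional to `exp (energy A θ z)`. -/
def isingPMF {n : ℕ} (A : Matrix (Fin n) (Fin n) ℝ) (θ : Fin n → ℝ) : PMF (Fin n → ℤˣ) :=
  PMF.normalize (fun z => ENNReal.ofReal (Real.exp (energy A θ z)))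
    (by
      rw [tsum_fintype]
      intro h
      have h1 := (Finset.sum_eq_zero_iff.mp h) (fun _ => 1) (Finset.mem_univ _)
      exact absurd (ENNReal.ofReal_eq_zero.mp h1) (not_le.mpr (Real.exp_pos _)))
    (by
      rw [tsum_fintype]
      exact ENNReal.sum_ne_top.mpr fun _ _ => ENNReal.ofReal_ne_top)

/-- The Ising model as a probability measure on `{-1, 1}ⁿ`. -/
def isingLaw {n : ℕ} (A : Matrix (Fin n) (Fin n) ℝ) (θ : Fin n → ℝ) : Measure (Fin n → ℤˣ) :=
  (isingPMF A θ).toMeasure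

instance {n : ℕ} (A : Matrix (Fin n) (Fin n) ℝ) (θ : Fin n → ℝ) :
    IsProbabilityMeasure (isingLaw A θ) := by
  unfold isingLaw; infer_instance

/-- The width `max_i (∑_j |A i j| + |θ i|)`. -/
def width {n : ℕ} (A : Matrix (Fin n) (Fin n) ℝ) (θ : Fin n → ℝ) : ℝ :=
  ⨆ i, (∑ j, |A i j| + |θ i|)

/-- Erase the entries of `z` whose mask bit is `false`; the symbol `?` is written as `0`. -/
def applyMask {n : ℕ} (zc : (Fin n → ℤˣ) × (Fin n → Bool)) : Fin n → ℤ :=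
  fun i => if zc.2 i then (zc.1 i : ℤ) else 0

/-- The law of one sample with missing data: draw `z` from the Ising model and, independently of `z`
and of the other entries, erase the `i`-th entry with probability `p i`. -/
def missLaw {n : ℕ} (A : Matrix (Fin n) (Fin n) ℝ) (θ : Fin n → ℝ) (p : Fin n → unitInterval) :
    Measure (Fin n → ℤ) :=
  ((isingLaw A θ).prod (Measure.pi fun i => bernoulliMeasure false true (p i))).map applyMask

instance {n : ℕ} (A : Matrix (Fin n) (Fin n) ℝ) (θ : Fin n → ℝ) (p : Fin n → unitInterval) :
    IsProbabilityMeasure (missLaw A θ p) :=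
  Measure.isProbabilityMeasure_map (Measurable.of_discrete.aemeasurable)

/-- The modified interaction screening objective at the vertex `r`. The vector `v` is indexed by the
vertices; its coordinate at `r` itself is the one that belongs to the external field. -/
def iso {n : ℕ} (A : Matrix (Fin n) (Fin n) ℝ) (θ : Fin n → ℝ) (r : Fin n) (v : Fin n → ℝ) : ℝ :=
  ∫ z, Real.exp (-∑ j ∈ Finset.univ.erase r, v j * ((z r : ℤ) : ℝ) * ((z j : ℤ) : ℝ)
    - v r * ((z r : ℤ) : ℝ)) ∂(isingLaw A θ)

/-- The true parameters at the vertex `r`: `A r i` at `i ≠ r`, and `θ r` at `r`. -/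
def truth {n : ℕ} (A : Matrix (Fin n) (Fin n) ℝ) (θ : Fin n → ℝ) (r : Fin n) : Fin n → ℝ :=
  fun i => if i = r then θ r else A r i

/-- The index set of the `2n + 1` simplex coordinates: `inl i` is the coordinate `i`,
`inr (inl i)` the coordinate `n + i`, and `inr (inr ())` the coordinate `2n + 1`. -/
abbrev Coord (n : ℕ) : Type := Fin n ⊕ (Fin n ⊕ Unit)

/-- The simplex of radius `W`. -/
def simplex (n : ℕ) (W : ℝ) : Set (Coord n → ℝ) := {w | (∀ k, 0 ≤ w k) ∧ ∑ k, w k = W}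

/-- The map `w ↦ (w_i - w_{n+i})_i` from the simplex to the `ℓ₁` ball. -/
def toBall {n : ℕ} (w : Coord n → ℝ) : Fin n → ℝ :=
  fun i => w (Sum.inl i) - w (Sum.inr (Sum.inl i))

/-- The factor `(exp (-v_j X_r X_j) - p_j) / (1 - p_j)`. -/
def missFactor {n : ℕ} (p : Fin n → unitInterval) (r : Fin n) (v : Fin n → ℝ) (x : Fin n → ℤ)
    (j : Fin n) : ℝ :=
  (Real.exp (-v j * (x r : ℝ) * (x j : ℝ)) - (p j : ℝ)) / (1 - (p j : ℝ))

/-- The estimators `g^i`, as functions of `v = toBall w`. -/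
def gMiss {n : ℕ} (p : Fin n → unitInterval) (r : Fin n) (v : Fin n → ℝ) (x : Fin n → ℤ)
    (i : Fin n) : ℝ :=
  if i = r then
    -(Real.exp (-v r * (x r : ℝ)) * (x r : ℝ) / (1 - (p r : ℝ)))
      * ∏ j ∈ Finset.univ.erase r, missFactor p r v x j
  else
    -(Real.exp (-v r * (x r : ℝ)) * (x r : ℝ) / (1 - (p r : ℝ)))
      * (Real.exp (-v i * (x r : ℝ) * (x i : ℝ)) * (x i : ℝ) / (1 - (p i : ℝ)))
      * ∏ j ∈ (Finset.univ.erase r).erase i, missFactor p r v x j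

/-- The gradient estimator `G(w; x) = ∑_i g^i(w; x) (e^i - e^{n+i})`. -/
def gradMiss {n : ℕ} (p : Fin n → unitInterval) (r : Fin n) (w : Coord n → ℝ) (x : Fin n → ℤ) :
    Coord n → ℝ
  | Sum.inl i => gMiss p r (toBall w) x i
  | Sum.inr (Sum.inl i) => -gMiss p r (toBall w) x i
  | Sum.inr (Sum.inr _) => 0

/-- One step of stochastic multiplicative gradient descent on the simplex of radius `W` with step
size `η` and gradient estimate `g`. -/
def smgStep {n : ℕ} (η W : ℝ) (w g : Coord n → ℝ) : Coord n → ℝ :=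
  fun k => w k * (1 - η * g k + η * ((∑ l, w l * g l) / W))

/-- The iterates of the algorithm on the samples `X`: `smgIterate p r η W X t` is the point reached
after the first `t` samples (constant once the samples are used up). -/
def smgIterate {n T : ℕ} (p : Fin n → unitInterval) (r : Fin n) (η W : ℝ)
    (X : Fin T → Fin n → ℤ) : ℕ → Coord n → ℝ
  | 0 => fun _ => W / (2 * n + 1)
  | t + 1 =>
      if h : t < T then
        smgStep η W (smgIterate p r η W X t) (gradMiss p r (smgIterate p r η W X t) (X ⟨t, h⟩))
      else smgIterate p r η W X t

/-- The output of the algorithm: the average of the `T` points at which the gradient estimates were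
taken. -/
def smgOutput {n T : ℕ} (p : Fin n → unitInterval) (r : Fin n) (η W : ℝ)
    (X : Fin T → Fin n → ℤ) : Coord n → ℝ :=
  fun k => (1 / (T : ℝ)) * ∑ t ∈ Finset.range T, smgIterate p r η W X t k

end

end MissingIsing

/-!
The interaction screening objective `S` is the mean of `exp (-(v ⬝ᵥ s))`, where `s` collects the
statistics `z_r z_j` and `z_r` seen from the vertex `r`. At the true parameters `v₀` the factor
`exp (-(v₀ ⬝ᵥ s))` removes the spin at `r` from the Gibbs weight, so the gradient, whose integrand
is odd in that spin, vanishes. The remainder `exp (-x) - 1 + x ≥ x ^ 2 / (2 + |x|)` bounds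
`S v - S v₀` from below by the second moment of `(v - v₀) ⬝ᵥ s`, and flipping the spin at `i`
changes this linear form by `2 * |v i - v₀ i|` while both configurations keep a conditional
probability of order `exp (-2 * lam)`.

Given `z`, the gradient of the loss is a product over the vertices, so correcting each factor for
the probability that it is erased gives an unbiased estimator from masked samples.

Multiplicative descent has regret `O(lam * log n / η + η * B ^ 2 * lam * T)` for gradient estimates
bounded by `B`, and the deviation between the estimated and the true gradients is a sum of `T`
adapted, conditionally centred and bounded terms, hence sub-Gaussian. By convexity the regret
controls the sum of `S (v t) - S v₀` over the iterates `v t`; strong convexity turns this into a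
bound on the sum of their squared errors, and Jensen's inequality passes to their mean.
-/

namespace MissingIsing

open Real Finset
open scoped Matrix

section ElementaryInequalities

lemma abs_dotProduct_le_sum_abs_mul {ι : Type*} [Fintype ι] (v : ι → ℝ) {s : ι → ℝ} {b : ℝ}
    (hs : ∀ j, |s j| ≤ b) : |v ⬝ᵥ s| ≤ (∑ j, |v j|) * b :=
  calc |v ⬝ᵥ s| ≤ ∑ j, |v j * s j| := abs_sum_le_sum_abs _ _
    _ ≤ ∑ j, |v j| * b := sum_le_sum fun j _ => by
        rw [abs_mul]; exact mul_le_mul_of_nonneg_left (hs j) (abs_nonneg _)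
    _ = (∑ j, |v j|) * b := (sum_mul ..).symm

lemma two_le_two_add_mul_exp_neg_add {x : ℝ} (hx : 0 ≤ x) : 2 ≤ (2 + x) * exp (-x) + x := by
  have hder : ∀ y : ℝ, HasDerivAt (fun y : ℝ => (2 + y) * exp (-y) + y)
      (1 - (y + 1) * exp (-y)) y := fun y =>
    ((((hasDerivAt_id' y).const_add 2).fun_mul (hasDerivAt_neg y).exp).fun_add
      (hasDerivAt_id' y)).congr_deriv (by ring)
  have hmono : Monotone fun y : ℝ => (2 + y) * exp (-y) + y := by
    refine monotone_of_deriv_nonneg (fun y => (hder y).differentiableAt) fun y => ?_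
    rw [(hder y).deriv, sub_nonneg]
    calc (y + 1) * exp (-y) ≤ exp y * exp (-y) :=
          mul_le_mul_of_nonneg_right (add_one_le_exp y) (exp_pos _).le
      _ = 1 := by rw [← exp_add, add_neg_cancel, exp_zero]
  simpa using hmono hx

lemma sq_div_two_add_abs_le (x : ℝ) : x ^ 2 / (2 + |x|) ≤ exp (-x) - 1 + x := by
  rw [div_le_iff₀ (by positivity)]
  rcases le_total 0 x with hx | hx
  · rw [abs_of_nonneg hx]
    linear_combination two_le_two_add_mul_exp_neg_add hx
  · obtain ⟨y, rfl⟩ : ∃ y, x = -y := ⟨-x, (neg_neg x).symm⟩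
    have hy : 0 ≤ y := neg_nonpos.1 hx
    rw [abs_neg, abs_of_nonneg hy, neg_neg]
    calc (-y) ^ 2 ≤ y ^ 2 / 2 * (2 + y) := by nlinarith [pow_nonneg hy 3]
      _ ≤ (exp y - 1 + -y) * (2 + y) :=
        mul_le_mul_of_nonneg_right (by linarith [quadratic_le_exp_of_nonneg hy]) (by positivity)

end ElementaryInequalities

section ExponentialLoss

variable {Ω ι : Type*} [MeasurableSpace Ω] [Fintype ι]

/-- The exponential loss of the parameter `v` for the statistic `s`; the interaction screening
objective is the case in which `s` consists of the products of spins seen from one vertex. -/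
noncomputable def expLoss (μ : Measure Ω) (s : Ω → ι → ℝ) (v : ι → ℝ) : ℝ :=
  ∫ z, exp (-(v ⬝ᵥ s z)) ∂μ

/-- The gradient of `expLoss`, as the vector of its partial derivatives. -/
noncomputable def expLossGrad (μ : Measure Ω) (s : Ω → ι → ℝ) (v : ι → ℝ) (i : ι) : ℝ :=
  -∫ z, exp (-(v ⬝ᵥ s z)) * s z i ∂μ

variable [Finite Ω] [MeasurableSingletonClass Ω] {μ : Measure Ω} [IsFiniteMeasure μ]
  {s : Ω → ι → ℝ}

lemma hasFDerivAt_expLoss (v : ι → ℝ) :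
    HasFDerivAt (expLoss μ s) (∑ i, expLossGrad μ s v i •
      ContinuousLinearMap.proj (R := ℝ) (φ := fun _ : ι => ℝ) i) v := by
  have := Fintype.ofFinite Ω
  have hexp : ∀ z, HasFDerivAt (fun v : ι → ℝ => exp (-(v ⬝ᵥ s z)))
      (exp (-(v ⬝ᵥ s z)) • -∑ i, s z i • ContinuousLinearMap.proj i) v := fun z =>
    (HasFDerivAt.fun_sum fun i _ => (hasFDerivAt_apply i v).mul_const (s z i)).neg.exp
  have hsum := HasFDerivAt.fun_sum fun z (_ : z ∈ univ) => (hexp z).const_mul (μ.real {z})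
  have hloss : expLoss μ s = fun v => ∑ z, μ.real {z} * exp (-(v ⬝ᵥ s z)) :=
    funext fun v => integral_fintype .of_finite
  rw [hloss]
  refine hsum.congr_fderiv (ContinuousLinearMap.ext fun d => ?_)
  simp only [expLossGrad, integral_fintype Integrable.of_finite, _root_.sum_apply,
    _root_.smul_apply, _root_.neg_apply, ContinuousLinearMap.proj_apply, smul_eq_mul, neg_mul,
    sum_mul, mul_neg, mul_sum, sum_neg_distrib]
  rw [sum_comm]
  exact congrArg Neg.neg (sum_congr rfl fun i _ => sum_congr rfl fun z _ => by ring)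

lemma expLossGrad_dotProduct (v d : ι → ℝ) :
    expLossGrad μ s v ⬝ᵥ d = -∫ z, exp (-(v ⬝ᵥ s z)) * (d ⬝ᵥ s z) ∂μ := by
  simp only [dotProduct, expLossGrad, neg_mul, sum_neg_distrib, ← integral_mul_const, mul_sum]
  rw [integral_finsetSum _ fun _ _ => .of_finite]
  exact congrArg Neg.neg (sum_congr rfl fun i _ => integral_congr_ae (ae_of_all _ fun z => by ring))

lemma expLoss_sub_sub_grad (v v₀ : ι → ℝ) :
    expLoss μ s v - expLoss μ s v₀ - expLossGrad μ s v₀ ⬝ᵥ (v - v₀)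
      = ∫ z, exp (-(v₀ ⬝ᵥ s z)) *
          (exp (-((v - v₀) ⬝ᵥ s z)) - 1 + (v - v₀) ⬝ᵥ s z) ∂μ := by
  rw [expLossGrad_dotProduct, expLoss, expLoss, sub_neg_eq_add,
    ← integral_sub .of_finite .of_finite, ← integral_add .of_finite .of_finite]
  refine integral_congr_ae (ae_of_all _ fun z => ?_)
  have hfactor : exp (-(v ⬝ᵥ s z)) = exp (-(v₀ ⬝ᵥ s z)) * exp (-((v - v₀) ⬝ᵥ s z)) := by
    rw [← exp_add, sub_dotProduct]; congr 1; ring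
  simp only [hfactor]
  ring

lemma expLossGrad_dotProduct_le (v v₀ : ι → ℝ) :
    expLossGrad μ s v₀ ⬝ᵥ (v - v₀) ≤ expLoss μ s v - expLoss μ s v₀ := by
  rw [← sub_nonneg, expLoss_sub_sub_grad]
  refine integral_nonneg fun z => mul_nonneg (exp_pos _).le ?_
  exact le_trans (by positivity) (sq_div_two_add_abs_le _)

lemma secondMoment_le_expLoss_sub_sub_grad {v v₀ : ι → ℝ} {R D : ℝ} (hR : ∀ z, v₀ ⬝ᵥ s z ≤ R)
    (hD : ∀ z, |(v - v₀) ⬝ᵥ s z| ≤ D) :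
    exp (-R) / (2 + D) * ∫ z, ((v - v₀) ⬝ᵥ s z) ^ 2 ∂μ
      ≤ expLoss μ s v - expLoss μ s v₀ - expLossGrad μ s v₀ ⬝ᵥ (v - v₀) := by
  rw [expLoss_sub_sub_grad, ← integral_const_mul]
  refine integral_mono .of_finite .of_finite fun z => ?_
  set x := (v - v₀) ⬝ᵥ s z
  calc exp (-R) / (2 + D) * x ^ 2 = exp (-R) * (x ^ 2 / (2 + D)) := by ring
    _ ≤ exp (-R) * (x ^ 2 / (2 + |x|)) := by gcongr; exact hD z
    _ ≤ exp (-(v₀ ⬝ᵥ s z)) * (exp (-x) - 1 + x) := by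
        gcongr
        exacts [hR z, sq_div_two_add_abs_le x]

end ExponentialLoss

section Spins

variable {V : Type*}

/-- The spin configuration `z` as a real vector. -/
def spin (z : V → ℤˣ) (i : V) : ℝ := ((z i : ℤ) : ℝ)

lemma spin_eq_or (z : V → ℤˣ) (i : V) : spin z i = 1 ∨ spin z i = -1 := by
  rcases Int.units_eq_one_or (z i) with h | h <;> simp [spin, h]

lemma abs_spin (z : V → ℤˣ) (i : V) : |spin z i| = 1 := by
  rcases spin_eq_or z i with h | h <;> simp [h]

/-- The local field at the vertex `i`: the spin at `i` enters the energy as `z_i` times it. -/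
def localField [Fintype V] (A : Matrix V V ℝ) (θ : V → ℝ) (i : V) (z : V → ℤˣ) : ℝ :=
  (A *ᵥ spin z) i + θ i

variable [DecidableEq V]

/-- The statistics seen from the vertex `r`, paired with the coordinates of `truth`: `z_r z_j` at
`j ≠ r`, and `z_r` at `r`. -/
def stat (r : V) (z : V → ℤˣ) (j : V) : ℝ := if j = r then spin z r else spin z r * spin z j

lemma abs_stat (r : V) (z : V → ℤˣ) (j : V) : |stat r z j| = 1 := by
  unfold stat
  split_ifs <;> simp [abs_mul, abs_spin]

/-- The configuration `z` with the spin at `i` reversed. -/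
def flipAt (i : V) (z : V → ℤˣ) : V → ℤˣ := Function.update z i (-z i)

lemma flipAt_involutive (i : V) : Function.Involutive (flipAt i) := fun z => by
  simp [flipAt]

lemma spin_flipAt_self (i : V) (z : V → ℤˣ) : spin (flipAt i z) i = -spin z i := by
  simp [spin, flipAt]

lemma spin_flipAt_of_ne {i j : V} (h : j ≠ i) (z : V → ℤˣ) :
    spin (flipAt i z) j = spin z j := by
  simp [spin, flipAt, h]

lemma spin_flipAt (i : V) (z : V → ℤˣ) :
    spin (flipAt i z) = spin z - Pi.single i (2 * spin z i) := by
  ext j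
  rcases eq_or_ne j i with rfl | h
  · rw [spin_flipAt_self, Pi.sub_apply, Pi.single_eq_same]; ring
  · rw [spin_flipAt_of_ne h, Pi.sub_apply, Pi.single_eq_of_ne h, sub_zero]

lemma stat_flipAt_root (r : V) (z : V → ℤˣ) (j : V) : stat r (flipAt r z) j = -stat r z j := by
  unfold stat
  split_ifs with h
  · exact spin_flipAt_self r z
  · rw [spin_flipAt_self, spin_flipAt_of_ne h, neg_mul]

lemma stat_flipAt {r i : V} (hi : i ≠ r) (z : V → ℤˣ) :
    stat r (flipAt i z) = stat r z - Pi.single i (2 * stat r z i) := by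
  ext j
  rcases eq_or_ne j i with rfl | h
  · simp only [stat, if_neg hi, spin_flipAt_self, spin_flipAt_of_ne hi.symm, Pi.sub_apply,
      Pi.single_eq_same]
    ring
  · simp only [stat, spin_flipAt_of_ne h, spin_flipAt_of_ne hi.symm, Pi.sub_apply,
      Pi.single_eq_of_ne h, sub_zero]

variable [Fintype V] {A : Matrix V V ℝ}

lemma localField_flipAt (hd : ∀ i, A i i = 0) (θ : V → ℝ) (i : V) (z : V → ℤˣ) :
    localField A θ i (flipAt i z) = localField A θ i z := by
  simp [localField, spin_flipAt, Matrix.mulVec_sub, hd]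

lemma sub_single_dotProduct_mulVec_sub_single (hA : A.IsSymm) (x : V → ℝ) (i : V) (c : ℝ) :
    (x - Pi.single i c) ⬝ᵥ A *ᵥ (x - Pi.single i c)
      = x ⬝ᵥ A *ᵥ x - 2 * c * (A *ᵥ x) i + c ^ 2 * A i i := by
  have hcross : x ⬝ᵥ A *ᵥ Pi.single i c = c * (A *ᵥ x) i := by
    rw [Matrix.dotProduct_mulVec, ← Matrix.mulVec_transpose, hA.eq, dotProduct_single, mul_comm]
  rw [Matrix.mulVec_sub, dotProduct_sub, sub_dotProduct, sub_dotProduct, hcross,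
    single_dotProduct, single_dotProduct, Matrix.mulVec_single]
  simp only [Pi.smul_apply, MulOpposite.smul_eq_mul_unop, MulOpposite.unop_op, Matrix.col_apply]
  ring

end Spins

section IsingModel

variable {n : ℕ} {A : Matrix (Fin n) (Fin n) ℝ} {θ : Fin n → ℝ}

lemma energy_eq (hA : A.IsSymm) (hd : ∀ i, A i i = 0) (z : Fin n → ℤˣ) :
    energy A θ z = (spin z ⬝ᵥ A *ᵥ spin z) / 2 + θ ⬝ᵥ spin z := by
  have hpairs : 2 * ∑ i, ∑ j ∈ Ioi i, A i j * spin z i * spin z j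
      = ∑ i, ∑ j, A i j * spin z i * spin z j :=
    calc 2 * ∑ i, ∑ j ∈ Ioi i, A i j * spin z i * spin z j
        = ∑ i, ∑ j ∈ Ioi i, (A j i * spin z j * spin z i + A i j * spin z i * spin z j) := by
          simp only [mul_sum]
          exact sum_congr rfl fun i _ => sum_congr rfl fun j _ => by rw [hA.apply i j]; ring
      _ = ∑ i, ∑ j ∈ {i}ᶜ, A j i * spin z j * spin z i :=
          sum_sum_Ioi_add_eq_sum_sum_off_diag fun i j => A i j * spin z i * spin z j
      _ = ∑ i, ∑ j, A j i * spin z j * spin z i :=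
          sum_congr rfl fun i _ => sum_subset (subset_univ _) fun j _ hj => by
            obtain rfl : j = i := by simpa using hj
            simp [hd]
      _ = ∑ i, ∑ j, A i j * spin z i * spin z j := sum_comm
  have hquad : ∑ i, ∑ j, A i j * spin z i * spin z j = spin z ⬝ᵥ A *ᵥ spin z := by
    simp only [dotProduct, Matrix.mulVec, mul_sum]
    exact sum_congr rfl fun i _ => sum_congr rfl fun j _ => by ring
  rw [← hquad, ← hpairs, mul_div_cancel_left₀ _ two_ne_zero]
  rfl

lemma energy_flipAt (hA : A.IsSymm) (hd : ∀ i, A i i = 0) (i : Fin n) (z : Fin n → ℤˣ) :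
    energy A θ (flipAt i z) = energy A θ z - 2 * (spin z i * localField A θ i z) := by
  rw [energy_eq hA hd, energy_eq hA hd, spin_flipAt,
    sub_single_dotProduct_mulVec_sub_single hA, hd, dotProduct_sub, dotProduct_single, localField]
  ring

lemma row_le_width (i : Fin n) : ∑ j, |A i j| + |θ i| ≤ width A θ :=
  le_ciSup (f := fun i => ∑ j, |A i j| + |θ i|) (Set.finite_range _).bddAbove i

lemma width_nonneg (r : Fin n) : 0 ≤ width A θ :=
  le_trans (by positivity) (row_le_width r)

lemma abs_localField_le_width (i : Fin n) (z : Fin n → ℤˣ) :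
    |localField A θ i z| ≤ width A θ :=
  calc |localField A θ i z| ≤ |A i ⬝ᵥ spin z| + |θ i| := abs_add_le _ _
    _ ≤ (∑ j, |A i j|) * 1 + |θ i| := by
        gcongr; exact abs_dotProduct_le_sum_abs_mul _ fun j => (abs_spin z j).le
    _ ≤ width A θ := by rw [mul_one]; exact row_le_width i

lemma sum_abs_truth_le_width (hd : ∀ i, A i i = 0) (r : Fin n) :
    ∑ i, |truth A θ r i| ≤ width A θ := by
  have hcoord : ∀ i, |truth A θ r i| = |A r i| + if i = r then |θ r| else 0 := by
    intro i
    unfold truth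
    split_ifs with h
    · rw [h, hd, abs_zero, zero_add]
    · rw [add_zero]
  simpa [hcoord, sum_add_distrib] using row_le_width r

lemma truth_dotProduct_stat (hd : ∀ i, A i i = 0) (r : Fin n) (z : Fin n → ℤˣ) :
    truth A θ r ⬝ᵥ stat r z = spin z r * localField A θ r z := by
  have hcoord : ∀ j, truth A θ r j * stat r z j
      = spin z r * (A r j * spin z j) + if j = r then spin z r * θ r else 0 := by
    intro j
    unfold truth stat
    split_ifs with h
    · rw [h, hd]; ring
    · ring
  simp only [dotProduct, hcoord, sum_add_distrib, localField, Matrix.mulVec, mul_add, mul_sum]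
  simp

/-- The partition function of the Ising model. -/
noncomputable def partitionFunction (A : Matrix (Fin n) (Fin n) ℝ) (θ : Fin n → ℝ) : ℝ :=
  ∑ z, exp (energy A θ z)

lemma partitionFunction_pos : 0 < partitionFunction A θ :=
  sum_pos (fun _ _ => exp_pos _) univ_nonempty

lemma isingLaw_real_singleton (z : Fin n → ℤˣ) :
    (isingLaw A θ).real {z} = exp (energy A θ z) / partitionFunction A θ := by
  rw [measureReal_def, isingLaw, PMF.toMeasure_apply_singleton _ _ (MeasurableSet.of_discrete),
    isingPMF, PMF.normalize_apply, tsum_fintype,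
    ← ENNReal.ofReal_sum_of_nonneg fun _ _ => (exp_pos _).le, ← partitionFunction,
    ENNReal.toReal_mul, ENNReal.toReal_ofReal (exp_pos _).le, ENNReal.toReal_inv,
    ENNReal.toReal_ofReal partitionFunction_pos.le, div_eq_mul_inv]

lemma integral_isingLaw (f : (Fin n → ℤˣ) → ℝ) :
    ∫ z, f z ∂(isingLaw A θ) = (∑ z, exp (energy A θ z) * f z) / partitionFunction A θ := by
  rw [integral_fintype .of_finite, sum_div]
  refine sum_congr rfl fun z _ => ?_
  rw [isingLaw_real_singleton, smul_eq_mul]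
  ring

-- The weights of `z` and `flipAt i z` are `exp (± z_i * localField A θ i z)` up to a common factor.
lemma integral_isingLaw_eq_sum_flipAt (hA : A.IsSymm) (hd : ∀ i, A i i = 0) (i : Fin n)
    (f : (Fin n → ℤˣ) → ℝ) :
    ∫ z, f z ∂(isingLaw A θ)
      = (∑ z, exp (energy A θ z - spin z i * localField A θ i z) *
          (exp (spin z i * localField A θ i z) * f z
            + exp (-(spin z i * localField A θ i z)) * f (flipAt i z)))
        / (2 * partitionFunction A θ) := by
  have hflip : ∑ z, exp (energy A θ (flipAt i z)) * f (flipAt i z)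
      = ∑ z, exp (energy A θ z) * f z :=
    Equiv.sum_comp ((flipAt_involutive i).toPerm _) fun z => exp (energy A θ z) * f z
  have hpair : ∀ z, exp (energy A θ z - spin z i * localField A θ i z) *
      (exp (spin z i * localField A θ i z) * f z
        + exp (-(spin z i * localField A θ i z)) * f (flipAt i z))
      = exp (energy A θ z) * f z + exp (energy A θ (flipAt i z)) * f (flipAt i z) := by
    intro z
    rw [mul_add, ← mul_assoc, ← mul_assoc, ← exp_add, ← exp_add, energy_flipAt hA hd]
    ring_nf
  rw [integral_isingLaw, sum_congr rfl fun z _ => hpair z, sum_add_distrib, hflip, ← two_mul,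
    mul_div_mul_left _ _ two_ne_zero]

end IsingModel

section RestrictedStrongConvexity

variable {n : ℕ} {A : Matrix (Fin n) (Fin n) ℝ} {θ : Fin n → ℝ} {lam : ℝ}

lemma iso_eq_expLoss (r : Fin n) : iso A θ r = expLoss (isingLaw A θ) (stat r) := by
  funext v
  refine integral_congr_ae (ae_of_all _ fun z => congrArg exp ?_)
  have hoff : ∑ j ∈ univ.erase r, v j * stat r z j
      = ∑ j ∈ univ.erase r, v j * ((z r : ℤ) : ℝ) * ((z j : ℤ) : ℝ) :=
    sum_congr rfl fun j hj => by
      rw [stat, if_neg (ne_of_mem_erase hj), spin, spin, mul_assoc]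
  rw [dotProduct, ← add_sum_erase _ _ (mem_univ r), hoff, stat, if_pos rfl, spin]
  ring

lemma abs_dotProduct_stat_le (r : Fin n) (v : Fin n → ℝ) (z : Fin n → ℤˣ) :
    |v ⬝ᵥ stat r z| ≤ ∑ j, |v j| := by
  simpa using abs_dotProduct_le_sum_abs_mul v fun j => (abs_stat r z j).le

-- At the true parameters the loss cancels the part of the energy that involves the spin at `r`, so
-- the integrand is odd in that spin.
lemma expLossGrad_truth (hA : A.IsSymm) (hd : ∀ i, A i i = 0) (r : Fin n) :
    expLossGrad (isingLaw A θ) (stat r) (truth A θ r) = 0 := by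
  ext i
  rw [expLossGrad, integral_isingLaw_eq_sum_flipAt hA hd r, sum_eq_zero fun z _ => ?_]
  · simp
  rw [truth_dotProduct_stat hd, truth_dotProduct_stat hd, spin_flipAt_self, localField_flipAt hd,
    stat_flipAt_root, neg_mul, neg_neg, ← mul_assoc, ← mul_assoc, ← exp_add, ← exp_add]
  simp

lemma exp_pair_mul_le {t d x y : ℝ} (ht : |t| ≤ lam) (hxy : (x - y) ^ 2 = 4 * d ^ 2) :
    exp t * (d ^ 2 * exp (-2 * lam)) + exp (-t) * (d ^ 2 * exp (-2 * lam))
      ≤ exp t * x ^ 2 + exp (-t) * y ^ 2 := by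
  obtain ⟨hneg, hpos⟩ := abs_le.1 ht
  have hle : ∀ {u}, u ≤ lam → exp u * (d ^ 2 * exp (-2 * lam)) ≤ exp (-lam) * d ^ 2 := by
    intro u hu
    rw [mul_left_comm, mul_comm, ← exp_add]
    gcongr
    linarith
  calc exp t * (d ^ 2 * exp (-2 * lam)) + exp (-t) * (d ^ 2 * exp (-2 * lam))
      ≤ exp (-lam) * d ^ 2 + exp (-lam) * d ^ 2 :=
        add_le_add (hle hpos) (hle (neg_le.1 hneg))
    _ = exp (-lam) * ((x - y) ^ 2 / 2) := by rw [hxy]; ring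
    _ ≤ exp (-lam) * (x ^ 2 + y ^ 2) := by gcongr; nlinarith [sq_nonneg (x + y)]
    _ = exp (-lam) * x ^ 2 + exp (-lam) * y ^ 2 := mul_add ..
    _ ≤ exp t * x ^ 2 + exp (-t) * y ^ 2 := by gcongr

-- Flipping the spin at `i` moves `d ⬝ᵥ stat r z` by `2 * |d i|`, and each of the two configurations
-- has conditional probability at least of order `exp (-2 * lam)`.
lemma sq_mul_exp_le_secondMoment (hA : A.IsSymm) (hd : ∀ i, A i i = 0) (hw : width A θ ≤ lam)
    {r i : Fin n} (hi : i ≠ r) (d : Fin n → ℝ) :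
    d i ^ 2 * exp (-2 * lam) ≤ ∫ z, (d ⬝ᵥ stat r z) ^ 2 ∂(isingLaw A θ) := by
  have hconst : d i ^ 2 * exp (-2 * lam) = ∫ _, d i ^ 2 * exp (-2 * lam) ∂(isingLaw A θ) := by simp
  rw [hconst, integral_isingLaw_eq_sum_flipAt hA hd i, integral_isingLaw_eq_sum_flipAt hA hd i]
  have := partitionFunction_pos (A := A) (θ := θ)
  refine div_le_div_of_nonneg_right (sum_le_sum fun z _ =>
    mul_le_mul_of_nonneg_left (exp_pair_mul_le ?_ ?_) (exp_pos _).le) (by positivity)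
  · rw [abs_mul, abs_spin, one_mul]
    exact (abs_localField_le_width i z).trans hw
  · have hsq : stat r z i ^ 2 = 1 := by rw [← sq_abs, abs_stat, one_pow]
    rw [stat_flipAt hi, dotProduct_sub, dotProduct_single]
    linear_combination 4 * d i ^ 2 * hsq

lemma sq_sub_le_iso_sub_sub_grad (hA : A.IsSymm) (hd : ∀ i, A i i = 0) (hw : width A θ ≤ lam)
    {r i : Fin n} {v : Fin n → ℝ} (hv : ∑ j, |v j| ≤ lam) (hi : i ≠ r) :
    exp (-3 * lam) / (2 * (1 + lam)) * (v i - A r i) ^ 2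
      ≤ iso A θ r v - iso A θ r (truth A θ r)
        - expLossGrad (isingLaw A θ) (stat r) (truth A θ r) ⬝ᵥ (v - truth A θ r) := by
  set d := v - truth A θ r
  have hlam : 0 ≤ lam := (width_nonneg r).trans hw
  have htruth : ∑ j, |truth A θ r j| ≤ lam := (sum_abs_truth_le_width hd r).trans hw
  have hdi : d i = v i - A r i := by simp [d, truth, hi]
  have hsum : ∑ j, |d j| ≤ 2 * lam :=
    calc ∑ j, |d j| ≤ ∑ j, (|v j| + |truth A θ r j|) := sum_le_sum fun j _ => abs_sub _ _
      _ ≤ 2 * lam := by rw [sum_add_distrib]; linarith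
  calc exp (-3 * lam) / (2 * (1 + lam)) * (v i - A r i) ^ 2
      = exp (-lam) / (2 + 2 * lam) * (d i ^ 2 * exp (-2 * lam)) := by
        rw [hdi, show -3 * lam = -lam + -2 * lam by ring, exp_add]; ring
    _ ≤ exp (-lam) / (2 + 2 * lam) * ∫ z, (d ⬝ᵥ stat r z) ^ 2 ∂(isingLaw A θ) := by
        gcongr; exact sq_mul_exp_le_secondMoment hA hd hw hi d
    _ ≤ _ := by
        rw [iso_eq_expLoss]
        exact secondMoment_le_expLoss_sub_sub_grad
          (fun z => (le_abs_self _).trans ((abs_dotProduct_stat_le r _ z).trans htruth))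
          fun z => (abs_dotProduct_stat_le r d z).trans hsum

theorem restricted_strong_convexity (hA : A.IsSymm) (hd : ∀ i, A i i = 0) (hw : width A θ ≤ lam)
    (r : Fin n) {v : Fin n → ℝ} (hv : ∑ i, |v i| ≤ lam) :
    iso A θ r v - iso A θ r (truth A θ r) ≥
      fderiv ℝ (iso A θ r) (truth A θ r) (v - truth A θ r)
        + exp (-3 * lam) / (2 * (1 + lam)) * ‖fun i : {i : Fin n // i ≠ r} => v i - A r i‖ ^ 2 := by
  have hfderiv : fderiv ℝ (iso A θ r) (truth A θ r) (v - truth A θ r)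
      = expLossGrad (isingLaw A θ) (stat r) (truth A θ r) ⬝ᵥ (v - truth A θ r) := by
    rw [iso_eq_expLoss, (hasFDerivAt_expLoss _).fderiv]
    simp [dotProduct, _root_.sum_apply]
  rw [hfderiv]
  rcases isEmpty_or_nonempty {i : Fin n // i ≠ r} with _ | _
  · have hconvex := expLossGrad_dotProduct_le (μ := isingLaw A θ) (s := stat r) v (truth A θ r)
    rw [Subsingleton.elim (fun i : {i : Fin n // i ≠ r} => v i - A r i) 0, iso_eq_expLoss]
    simpa using hconvex
  · obtain ⟨i, hi⟩ := Finite.exists_max fun i : {i : Fin n // i ≠ r} => ‖v i - A r i‖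
    have hlam : 0 ≤ lam := (width_nonneg r).trans hw
    have hnorm : exp (-3 * lam) / (2 * (1 + lam))
        * ‖fun i : {i : Fin n // i ≠ r} => v i - A r i‖ ^ 2
        ≤ exp (-3 * lam) / (2 * (1 + lam)) * (v i - A r i) ^ 2 := by
      rw [← sq_abs (v i - A r i), ← Real.norm_eq_abs]
      gcongr
      exact (pi_norm_le_iff_of_nonempty _).2 hi
    linarith [sq_sub_le_iso_sub_sub_grad hA hd hw hv i.2]

end RestrictedStrongConvexity

section InverseProbabilityWeighting

/-- Inverse probability weighting: the estimator of `h s` from an observation `y` that is `s` with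
probability `1 - q` and is erased, that is `0`, with probability `q`. -/
noncomputable def unmask (q : ℝ) (h : ℝ → ℝ) (y : ℝ) : ℝ := (h y - q * h 0) / (1 - q)

lemma integral_unmask {q : unitInterval} (hq : (q : ℝ) < 1) (h : ℝ → ℝ) (s : ℝ) :
    ∫ b, unmask q h (if b then s else 0) ∂(bernoulliMeasure false true q) = h s := by
  have hq' : 1 - (q : ℝ) ≠ 0 := (sub_pos.2 hq).ne'
  simp only [integral_bernoulliMeasure, unmask, smul_eq_mul, if_true, Bool.false_eq_true, if_false]
  field_simp
  ring

lemma abs_exp_sub_div_le {p q s a : ℝ} (hp : 0 ≤ p) (hpq : p ≤ q) (hq : q < 1) (hs : |s| ≤ a) :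
    |(exp s - p) / (1 - p)| ≤ exp (a / (1 - q)) := by
  obtain ⟨u, rfl⟩ : ∃ u, a = (1 - q) * u := ⟨a / (1 - q), by field_simp [(sub_pos.2 hq).ne']⟩
  have hq' : 0 < 1 - q := sub_pos.2 hq
  have hp' : 0 < 1 - p := by linarith
  have hu : 0 ≤ u := nonneg_of_mul_nonneg_right ((abs_nonneg s).trans hs) hq'
  have hsu : |s| ≤ (1 - p) * u := hs.trans (by gcongr)
  rw [mul_div_cancel_left₀ _ hq'.ne', abs_div, abs_of_pos hp', div_le_iff₀ hp', abs_le]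
  constructor
  · nlinarith [add_one_le_exp s, mul_le_mul_of_nonneg_left (add_one_le_exp u) hp'.le, neg_abs_le s]
  · have hconvex := convexOn_exp.2 (Set.mem_univ 0) (Set.mem_univ u) hp hp'.le (by ring)
    simp only [smul_eq_mul, mul_zero, zero_add, exp_zero, mul_one] at hconvex
    linarith [exp_le_exp.2 ((le_abs_self s).trans hsu)]

lemma abs_exp_mul_div_le {p q s a c : ℝ} (hp : 0 ≤ p) (hpq : p ≤ q) (hq : q < 1) (hs : |s| ≤ a)
    (hc : |c| ≤ 1) : |exp s * c / (1 - p)| ≤ 1 / (1 - q) * exp (a / (1 - q)) := by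
  have hq' : 0 < 1 - q := sub_pos.2 hq
  have ha : 0 ≤ a := (abs_nonneg s).trans hs
  have hexp : exp s ≤ exp (a / (1 - q)) :=
    exp_le_exp.2 (((le_abs_self s).trans hs).trans (le_div_self ha hq' (by linarith)))
  rw [abs_div, abs_mul, abs_exp, abs_of_pos (by linarith : 0 < 1 - p), one_div_mul_eq_div]
  gcongr
  exact (mul_le_of_le_one_right (exp_pos _).le hc).trans hexp

end InverseProbabilityWeighting

section GradientEstimator

variable {n : ℕ} {A : Matrix (Fin n) (Fin n) ℝ} {θ : Fin n → ℝ} {p : Fin n → unitInterval}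
  {pmax lam : ℝ}

/-- The factor contributed by the vertex `j` to `exp (-(v ⬝ᵥ stat r z)) * stat r z i`, as a function
of the spin `y` at `j` and of the spin `s` at `r`. -/
noncomputable def gradTerm (r : Fin n) (v : Fin n → ℝ) (i : Fin n) (s : ℝ) (j : Fin n) (y : ℝ) :
    ℝ :=
  exp (-(v j * if j = r then y else s * y)) * if j = r ∨ j = i then y else 1

lemma prod_gradTerm_spin (r : Fin n) (v : Fin n → ℝ) (i : Fin n) (z : Fin n → ℤˣ) :
    ∏ j, gradTerm r v i (spin z r) j (spin z j) = exp (-(v ⬝ᵥ stat r z)) * stat r z i := by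
  have hstat : ∏ j, (if j = r ∨ j = i then spin z j else 1) = stat r z i := by
    rcases eq_or_ne i r with rfl | hi
    · simp [stat]
    · rw [stat, if_neg hi, ← prod_pair hi.symm, ← univ_inter {r, i}, ← prod_ite_mem]
      simp
  have hexp : ∀ j, v j * (if j = r then spin z j else spin z r * spin z j) = v j * stat r z j := by
    intro j
    unfold stat
    split_ifs with hj <;> simp [hj]
  simp only [gradTerm, hexp, prod_mul_distrib, hstat, ← exp_sum, sum_neg_distrib, dotProduct]

lemma gMiss_eq_neg_prod_unmask (p : Fin n → unitInterval) (r : Fin n) (v : Fin n → ℝ)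
    (x : Fin n → ℤ) (i : Fin n) :
    gMiss p r v x i = -∏ j, unmask (p j) (gradTerm r v i (x r) j) (x j) := by
  have hroot : unmask (p r) (gradTerm r v i (x r) r) (x r)
      = exp (-v r * (x r : ℝ)) * (x r : ℝ) / (1 - (p r : ℝ)) := by
    simp [unmask, gradTerm]
  have hother : ∀ j, j ≠ r → j ≠ i →
      unmask (p j) (gradTerm r v i (x r) j) (x j) = missFactor p r v x j := by
    intro j hjr hji
    simp [unmask, gradTerm, missFactor, hjr, hji, mul_assoc]
  rw [← mul_prod_erase _ _ (mem_univ r), hroot, gMiss, ← neg_mul]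
  split_ifs with hi
  · rw [prod_congr rfl fun j hj => hother j (ne_of_mem_erase hj) (hi ▸ ne_of_mem_erase hj)]
  · have hedge : unmask (p i) (gradTerm r v i (x r) i) (x i)
        = exp (-v i * (x r : ℝ) * (x i : ℝ)) * (x i : ℝ) / (1 - (p i : ℝ)) := by
      simp [unmask, gradTerm, hi, mul_assoc]
    rw [← mul_prod_erase _ _ (mem_erase.2 ⟨hi, mem_univ i⟩), hedge, mul_assoc,
      prod_congr rfl fun j hj =>
        hother j (ne_of_mem_erase (mem_of_mem_erase hj)) (ne_of_mem_erase hj)]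

lemma applyMask_cast (z : Fin n → ℤˣ) (m : Fin n → Bool) (i : Fin n) :
    ((applyMask (z, m) i : ℤ) : ℝ) = if m i then spin z i else 0 := by
  unfold applyMask spin
  split_ifs <;> simp

-- If the spin at `r` is masked, both sides vanish: the factor at `r` is `0`.
lemma gMiss_applyMask (p : Fin n → unitInterval) (r : Fin n) (v : Fin n → ℝ) (z : Fin n → ℤˣ)
    (m : Fin n → Bool) (i : Fin n) :
    gMiss p r v (applyMask (z, m)) i
      = -∏ j, unmask (p j) (gradTerm r v i (spin z r) j) (if m j then spin z j else 0) := by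
  rw [gMiss_eq_neg_prod_unmask]
  simp only [applyMask_cast]
  by_cases hm : m r
  · simp only [if_pos hm]
  · have hzero : ∀ s, unmask (p r) (gradTerm r v i s r) (if m r then spin z r else 0) = 0 := by
      simp [hm, unmask, gradTerm]
    rw [prod_eq_zero (mem_univ r) (hzero _), prod_eq_zero (mem_univ r) (hzero _)]

theorem integral_gMiss (hp : ∀ i, (p i : ℝ) < 1) (r : Fin n) (v : Fin n → ℝ) (i : Fin n) :
    ∫ x, gMiss p r v x i ∂(missLaw A θ p) = expLossGrad (isingLaw A θ) (stat r) v i := by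
  rw [missLaw, integral_map Measurable.of_discrete.aemeasurable
    Measurable.of_discrete.aestronglyMeasurable, integral_prod _ .of_finite, expLossGrad,
    ← integral_neg]
  refine integral_congr_ae (ae_of_all _ fun z => ?_)
  simp only [gMiss_applyMask, integral_neg]
  rw [integral_fintype_prod_eq_prod (f := fun j (b : Bool) =>
    unmask (p j) (gradTerm r v i (spin z r) j) (if b then spin z j else 0))]
  simp only [integral_unmask (hp _), prod_gradTerm_spin]

lemma hasFDerivAt_toBall (w : Coord n → ℝ) :
    HasFDerivAt toBall (ContinuousLinearMap.pi fun i : Fin n =>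
      ContinuousLinearMap.proj (R := ℝ) (φ := fun _ : Coord n => ℝ) (Sum.inl i)
        - ContinuousLinearMap.proj (Sum.inr (Sum.inl i))) w :=
  hasFDerivAt_pi.2 fun i => (hasFDerivAt_apply (Sum.inl i) w).fun_sub (hasFDerivAt_apply _ w)

theorem hasFDerivAt_iso_toBall (hp : ∀ i, (p i : ℝ) < 1) (r : Fin n) (w : Coord n → ℝ) :
    HasFDerivAt (fun u => iso A θ r (toBall u))
      (∑ k, (∫ x, gradMiss p r w x k ∂(missLaw A θ p)) •
        ContinuousLinearMap.proj (R := ℝ) (φ := fun _ : Coord n => ℝ) k) w := by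
  rw [iso_eq_expLoss]
  refine ((hasFDerivAt_expLoss (μ := isingLaw A θ) (s := stat r) _).comp w
    (hasFDerivAt_toBall w)).congr_fderiv ?_
  ext u
  simp [_root_.sum_apply, Fintype.sum_sum_type, gradMiss, integral_gMiss hp, integral_neg,
    mul_add, sum_add_distrib, sub_eq_add_neg]

lemma abs_unmask_gradTerm_le {q : ℝ} (hq₀ : 0 ≤ q) (hqmax : q ≤ pmax) (hpmax : pmax < 1)
    (r : Fin n) (v : Fin n → ℝ) (i j : Fin n) {s y : ℝ} (hs : |s| ≤ 1) (hy : |y| ≤ 1) :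
    |unmask q (gradTerm r v i s j) y|
      ≤ (if j = r ∨ j = i then 1 / (1 - pmax) else 1) * exp (|v j| / (1 - pmax)) := by
  have hexponent : |(-(v j * if j = r then y else s * y))| ≤ |v j| := by
    rw [abs_neg, abs_mul]
    refine mul_le_of_le_one_right (abs_nonneg _) ?_
    split_ifs
    exacts [hy, (abs_mul s y).trans_le (mul_le_one₀ hs (abs_nonneg y) hy)]
  by_cases hj : j = r ∨ j = i
  · simpa [unmask, gradTerm, hj] using abs_exp_mul_div_le hq₀ hqmax hpmax hexponent hy
  · simpa [unmask, gradTerm, hj] using abs_exp_sub_div_le hq₀ hqmax hpmax hexponent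

/-- The possible samples: every entry is a spin or the symbol `0` for a missing value. -/
def observations (n : ℕ) : Set (Fin n → ℤ) := {x | ∀ i, x i = -1 ∨ x i = 0 ∨ x i = 1}

lemma abs_gMiss_le (r : Fin n) (hq : pmax < 1) (hp : ∀ i, (p i : ℝ) ≤ pmax) {v : Fin n → ℝ}
    (hv : ∑ i, |v i| ≤ lam) {x : Fin n → ℤ} (hx : x ∈ observations n) (i : Fin n) :
    |gMiss p r v x i| ≤ 1 / (1 - pmax) ^ 2 * exp (lam / (1 - pmax)) := by
  have hq' : 0 < 1 - pmax := sub_pos.2 hq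
  have hone : 1 ≤ 1 / (1 - pmax) := (one_le_div hq').2 (by linarith [(p r).2.1.trans (hp r)])
  have hx1 : ∀ i, |(x i : ℝ)| ≤ 1 := fun i => by rcases hx i with h | h | h <;> simp [h]
  have hweights : ∏ j, (if j = r ∨ j = i then 1 / (1 - pmax) else 1) ≤ (1 / (1 - pmax)) ^ 2 :=
    calc ∏ j, (if j = r ∨ j = i then 1 / (1 - pmax) else 1)
        = ∏ j, (if j ∈ ({r, i} : Finset (Fin n)) then 1 / (1 - pmax) else 1) := by simp
      _ = (1 / (1 - pmax)) ^ #{r, i} := by rw [prod_ite_mem, univ_inter, prod_const]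
      _ ≤ (1 / (1 - pmax)) ^ 2 := pow_le_pow_right₀ hone card_le_two
  rw [gMiss_eq_neg_prod_unmask, abs_neg, abs_prod]
  calc ∏ j, |unmask (p j) (gradTerm r v i (x r) j) (x j)|
      ≤ ∏ j, ((if j = r ∨ j = i then 1 / (1 - pmax) else 1) * exp (|v j| / (1 - pmax))) :=
        prod_le_prod (fun _ _ => abs_nonneg _) fun j _ =>
          abs_unmask_gradTerm_le (p j).2.1 (hp j) hq r v i j (hx1 r) (hx1 j)
    _ = (∏ j, (if j = r ∨ j = i then 1 / (1 - pmax) else 1)) * exp ((∑ j, |v j|) / (1 - pmax)) := by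
        rw [prod_mul_distrib, ← exp_sum, sum_div]
    _ ≤ (1 / (1 - pmax)) ^ 2 * exp (lam / (1 - pmax)) := by gcongr
    _ = 1 / (1 - pmax) ^ 2 * exp (lam / (1 - pmax)) := by rw [one_div_pow]

lemma sum_abs_toBall_le {w : Coord n → ℝ} (hw : w ∈ simplex n lam) :
    ∑ i, |toBall w i| ≤ lam := by
  obtain ⟨hnonneg, hsum⟩ := hw
  have hcoord : ∀ i, |toBall w i| ≤ w (Sum.inl i) + w (Sum.inr (Sum.inl i)) := fun i => by
    have hinl := hnonneg (Sum.inl i)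
    have hinr := hnonneg (Sum.inr (Sum.inl i))
    exact abs_le.2 ⟨by unfold toBall; linarith, by unfold toBall; linarith⟩
  calc ∑ i, |toBall w i| ≤ ∑ i, w (Sum.inl i) + ∑ i, w (Sum.inr (Sum.inl i)) := by
        rw [← sum_add_distrib]; exact sum_le_sum fun i _ => hcoord i
    _ ≤ ∑ i, w (Sum.inl i) + (∑ i, w (Sum.inr (Sum.inl i)) + ∑ k, w (Sum.inr (Sum.inr k))) := by
        gcongr; exact le_add_of_nonneg_right (sum_nonneg fun k _ => hnonneg _)
    _ = lam := by rw [← hsum, Fintype.sum_sum_type, Fintype.sum_sum_type]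

theorem norm_gradMiss_le (r : Fin n) (hq : pmax < 1) (hp : ∀ i, (p i : ℝ) ≤ pmax)
    {w : Coord n → ℝ} (hw : w ∈ simplex n lam) {x : Fin n → ℤ} (hx : x ∈ observations n) :
    ‖gradMiss p r w x‖ ≤ 1 / (1 - pmax) ^ 2 * exp (lam / (1 - pmax)) := by
  have hbound := abs_gMiss_le r hq hp (sum_abs_toBall_le hw) hx
  refine (pi_norm_le_iff_of_nonneg (by positivity)).2 ?_
  rintro (i | i | i)
  · exact hbound i
  · simpa [gradMiss] using hbound i
  · simpa [gradMiss] using (abs_nonneg _).trans (hbound r)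

lemma ae_missLaw_mem_observations (p : Fin n → unitInterval) :
    ∀ᵐ x ∂(missLaw A θ p), x ∈ observations n := by
  rw [missLaw, ae_map_iff Measurable.of_discrete.aemeasurable MeasurableSet.of_discrete]
  refine ae_of_all _ fun zc i => ?_
  unfold applyMask
  rcases Int.units_eq_one_or (zc.1 i) with h | h <;> by_cases hb : zc.2 i <;> simp [h, hb]

end GradientEstimator

section AdaptedSum

lemma hasSubgaussianMGF_prod_add {Ω Ω' : Type*} [MeasurableSpace Ω] [MeasurableSpace Ω']
    {μ : Measure Ω} {ν : Measure Ω'} [SFinite μ] [SFinite ν] {X : Ω → ℝ} {Y : Ω → Ω' → ℝ}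
    {a b : NNReal} (hX : HasSubgaussianMGF X a μ) (hYm : Measurable (Function.uncurry Y))
    (hY : ∀ᵐ x ∂μ, HasSubgaussianMGF (Y x) b ν) :
    HasSubgaussianMGF (fun z => X z.1 + Y z.1 z.2) (a + b) (μ.prod ν) := by
  have hexp (t : ℝ) (x : Ω) (y : Ω') :
      exp (t * (X x + Y x y)) = exp (t * X x) * exp (t * Y x y) := by
    rw [mul_add, exp_add]
  have hbound (t : ℝ) :
      ∀ᵐ x ∂μ, ∫ y, exp (t * (X x + Y x y)) ∂ν ≤ exp (t * X x) * exp (b * t ^ 2 / 2) := by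
    filter_upwards [hY] with x hx
    simp only [hexp, integral_const_mul]
    exact mul_le_mul_of_nonneg_left (hx.mgf_le t) (exp_pos _).le
  have hint (t : ℝ) : Integrable (fun z => exp (t * (X z.1 + Y z.1 z.2))) (μ.prod ν) := by
    have hmeas : AEStronglyMeasurable (fun z => exp (t * (X z.1 + Y z.1 z.2))) (μ.prod ν) :=
      (((hX.aemeasurable.comp_fst.add hYm.aemeasurable).const_mul t).exp).aestronglyMeasurable
    refine (integrable_prod_iff hmeas).2 ⟨?_, ?_⟩
    · filter_upwards [hY] with x hx
      simpa only [hexp] using (hx.integrable_exp_mul t).const_mul _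
    · simp only [norm_of_nonneg (exp_pos _).le]
      refine ((hX.integrable_exp_mul t).mul_const (exp (b * t ^ 2 / 2))).mono'
        hmeas.integral_prod_right' ?_
      filter_upwards [hbound t] with x hx
      exact (norm_of_nonneg (integral_nonneg fun _ => (exp_pos _).le)).trans_le hx
  refine ⟨hint, fun t => ?_⟩
  calc ∫ z, exp (t * (X z.1 + Y z.1 z.2)) ∂(μ.prod ν)
      = ∫ x, ∫ y, exp (t * (X x + Y x y)) ∂ν ∂μ := integral_prod _ (hint t)
    _ ≤ ∫ x, exp (t * X x) * exp (b * t ^ 2 / 2) ∂μ :=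
        integral_mono_ae (hint t).integral_prod_left ((hX.integrable_exp_mul t).mul_const _)
          (hbound t)
    _ = mgf X μ t * exp (b * t ^ 2 / 2) := integral_mul_const _ _
    _ ≤ exp (a * t ^ 2 / 2) * exp (b * t ^ 2 / 2) :=
        mul_le_mul_of_nonneg_right (hX.mgf_le t) (exp_pos _).le
    _ = exp ((a + b : NNReal) * t ^ 2 / 2) := by
        rw [← exp_add, NNReal.coe_add]; ring_nf

/-- The states reached from `s` by feeding the inputs `X` one after another to the transition
function `F`, constant once the inputs are used up. -/
def run {S Ω : Type*} (F : S → Ω → S) (s : S) {T : ℕ} (X : Fin T → Ω) : ℕ → S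
  | 0 => s
  | t + 1 => if h : t < T then F (run F s X t) (X ⟨t, h⟩) else run F s X t

variable {S Ω : Type*} {F : S → Ω → S} {good : Set S}

lemma run_succ (F : S → Ω → S) (s : S) {T : ℕ} (X : Fin (T + 1) → Ω) (t : ℕ) :
    run F s X (t + 1) = run F (F s (X 0)) (Fin.tail X) t := by
  induction t with
  | zero => simp only [run, Nat.zero_lt_succ, dif_pos, Fin.mk_zero]
  | succ t ih =>
    rw [run, ih, run]
    by_cases h : t < T
    · rw [dif_pos (Nat.succ_lt_succ h), dif_pos h]
      rfl
    · rw [dif_neg (fun h' => h (Nat.lt_of_succ_lt_succ h')), dif_neg h]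

lemma sum_run_succ {M : Type*} [AddCommMonoid M] (F : S → Ω → S) (φ : S → Ω → M) (s : S) {T : ℕ}
    (X : Fin (T + 1) → Ω) :
    ∑ t : Fin (T + 1), φ (run F s X t) (X t)
      = φ s (X 0) + ∑ t : Fin T, φ (run F (F s (X 0)) (Fin.tail X) t) (Fin.tail X t) := by
  rw [Fin.sum_univ_succ]
  simp only [Fin.val_zero, run, Fin.val_succ, run_succ, Fin.tail]

lemma run_mem {ok : Set Ω} (hF : ∀ s ∈ good, ∀ x ∈ ok, F s x ∈ good) {s : S} (hs : s ∈ good)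
    {T : ℕ} {X : Fin T → Ω} (hX : ∀ t, X t ∈ ok) (t : ℕ) : run F s X t ∈ good := by
  induction t with
  | zero => exact hs
  | succ t ih =>
    rw [run]
    split_ifs with h
    · exact hF _ ih _ (hX _)
    · exact ih

variable [MeasurableSpace Ω] [Countable Ω] [MeasurableSingletonClass Ω] {μ : Measure Ω}
  [IsProbabilityMeasure μ]

lemma hasSubgaussianMGF_sum_run {φ : S → Ω → ℝ} {c : NNReal}
    (hF : ∀ s ∈ good, ∀ᵐ x ∂μ, F s x ∈ good) (hφ : ∀ s ∈ good, HasSubgaussianMGF (φ s) c μ)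
    (T : ℕ) {s : S} (hs : s ∈ good) :
    HasSubgaussianMGF (fun X => ∑ t : Fin T, φ (run F s X t) (X t)) (T * c)
      (Measure.pi fun _ => μ) := by
  induction T generalizing s with
  | zero => simp
  | succ T ih =>
    have hsplit := measurePreserving_piFinSuccAbove (fun _ : Fin (T + 1) => μ) 0
    have hstep : HasSubgaussianMGF
        (fun z : Ω × (Fin T → Ω) => φ s z.1 + ∑ t : Fin T, φ (run F (F s z.1) z.2 t) (z.2 t))
        (c + T * c) (μ.prod (Measure.pi fun _ => μ)) := by
      refine hasSubgaussianMGF_prod_add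
        (Y := fun x X => ∑ t : Fin T, φ (run F (F s x) X t) (X t)) (hφ s hs)
        Measurable.of_discrete ?_
      filter_upwards [hF s hs] with x hx
      exact ih hx
    rw [← hsplit.map_eq] at hstep
    rw [Nat.cast_succ, add_mul, one_mul, add_comm (T * c)]
    exact (HasSubgaussianMGF.of_map hsplit.measurable.aemeasurable hstep).congr
      (ae_of_all _ fun X => (sum_run_succ F φ s X).symm)

end AdaptedSum

section MultiplicativeDescent

/-- The positive vectors of total mass `W`, the interior of the simplex of radius `W`. -/
def openSimplex (ι : Type*) [Fintype ι] (W : ℝ) : Set (ι → ℝ) :=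
  {w | (∀ k, 0 < w k) ∧ ∑ k, w k = W}

variable {ι : Type*} [Fintype ι]

/-- One step of multiplicative gradient descent on the simplex of radius `W`. Subtracting the
`w`-average of `g` preserves the total mass. -/
noncomputable def simplexStep (η W : ℝ) (w g : ι → ℝ) : ι → ℝ :=
  fun k => w k * (1 - η * (g k - w ⬝ᵥ g / W))

variable {η W B : ℝ} {w g u : ι → ℝ}

lemma abs_dotProduct_le_of_nonneg (hw : ∀ k, 0 ≤ w k) (hW : ∑ k, w k = W)
    (hg : ∀ k, |g k| ≤ B) : |w ⬝ᵥ g| ≤ W * B := by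
  simpa only [abs_of_nonneg (hw _), hW] using abs_dotProduct_le_sum_abs_mul w hg

lemma abs_dotProduct_sub_le_of_nonneg (hw : w ∈ openSimplex ι W) (hu : ∀ k, 0 ≤ u k)
    (huW : ∑ k, u k = W) (hg : ∀ k, |g k| ≤ B) : |g ⬝ᵥ (w - u)| ≤ 2 * (W * B) := by
  rw [dotProduct_sub, dotProduct_comm g, dotProduct_comm g, two_mul]
  exact (abs_sub _ _).trans (add_le_add
    (abs_dotProduct_le_of_nonneg (fun k => (hw.1 k).le) hw.2 hg)
    (abs_dotProduct_le_of_nonneg hu huW hg))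

lemma abs_mul_sub_dotProduct_div_le (hη : 0 ≤ η) (hW : 0 < W) (hw : w ∈ openSimplex ι W)
    (hg : ∀ k, |g k| ≤ B) (k : ι) : |η * (g k - w ⬝ᵥ g / W)| ≤ 2 * (η * B) := by
  have hmean : |w ⬝ᵥ g / W| ≤ B := by
    rw [abs_div, abs_of_pos hW, div_le_iff₀' hW]
    exact abs_dotProduct_le_of_nonneg (fun k => (hw.1 k).le) hw.2 hg
  rw [abs_mul, abs_of_nonneg hη, mul_left_comm]
  refine mul_le_mul_of_nonneg_left ?_ hη
  linarith [abs_sub (g k) (w ⬝ᵥ g / W), hg k]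

lemma simplexStep_mem (hη : 0 ≤ η) (hW : 0 < W) (hηB : 4 * (η * B) ≤ 1)
    (hw : w ∈ openSimplex ι W) (hg : ∀ k, |g k| ≤ B) :
    simplexStep η W w g ∈ openSimplex ι W := by
  refine ⟨fun k => mul_pos (hw.1 k) ?_, ?_⟩
  · linarith [(abs_le.1 (abs_mul_sub_dotProduct_div_le hη hW hw hg k)).2]
  · calc ∑ k, simplexStep η W w g k
        = ∑ k, w k - η * (w ⬝ᵥ g - (∑ k, w k) * (w ⬝ᵥ g / W)) := by
          rw [dotProduct, sum_mul, ← sum_sub_distrib, mul_sum, ← sum_sub_distrib]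
          exact sum_congr rfl fun k _ => by rw [simplexStep, dotProduct]; ring
      _ = W := by
          rw [hw.2, mul_div_cancel₀ _ hW.ne', sub_self, mul_zero, sub_zero]

lemma neg_sub_two_mul_sq_le_log_one_sub {x : ℝ} (hx : |x| ≤ 1 / 2) :
    -x - 2 * x ^ 2 ≤ log (1 - x) := by
  have hx₂ := (abs_le.1 hx).2
  have hpos : 0 < 1 - x := by linarith
  refine le_trans ?_ (one_sub_inv_le_log_of_pos hpos)
  rw [← sub_nonneg]
  have hdiff : 1 - (1 - x)⁻¹ - (-x - 2 * x ^ 2) = x ^ 2 * (1 - 2 * x) / (1 - x) := by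
    field_simp
    ring
  rw [hdiff]
  exact div_nonneg (mul_nonneg (sq_nonneg x) (by linarith)) hpos.le

lemma neg_sub_le_log_simplexStep_sub_log (hη : 0 ≤ η) (hW : 0 < W) (hηB : 4 * (η * B) ≤ 1)
    (hw : w ∈ openSimplex ι W) (hg : ∀ k, |g k| ≤ B) (k : ι) :
    -(η * (g k - w ⬝ᵥ g / W)) - 8 * (η * B) ^ 2
      ≤ log (simplexStep η W w g k) - log (w k) := by
  have hx := abs_mul_sub_dotProduct_div_le hη hW hw hg k
  have hsq := sq_le_sq' (abs_le.1 hx).1 (abs_le.1 hx).2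
  have hlog := neg_sub_two_mul_sq_le_log_one_sub (hx.trans (by linarith))
  have hpos : 0 < 1 - η * (g k - w ⬝ᵥ g / W) := by linarith [(abs_le.1 hx).2]
  rw [simplexStep, log_mul (hw.1 k).ne' hpos.ne']
  linarith

lemma mul_dotProduct_sub_le (hη : 0 ≤ η) (hW : 0 < W) (hηB : 4 * (η * B) ≤ 1)
    (hw : w ∈ openSimplex ι W) (hg : ∀ k, |g k| ≤ B) (hu : ∀ k, 0 ≤ u k)
    (huW : ∑ k, u k = W) :
    η * (g ⬝ᵥ (w - u)) ≤ ∑ k, u k * log (simplexStep η W w g k) - ∑ k, u k * log (w k)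
      + 8 * (η * B) ^ 2 * W := by
  have hlog := sum_le_sum fun k (_ : k ∈ univ) => mul_le_mul_of_nonneg_left
    (neg_sub_le_log_simplexStep_sub_log hη hW hηB hw hg k) (hu k)
  have hlhs : ∑ k, u k * (-(η * (g k - w ⬝ᵥ g / W)) - 8 * (η * B) ^ 2)
      = η * (g ⬝ᵥ (w - u)) - 8 * (η * B) ^ 2 * W := by
    calc _ = (∑ k, u k) * (η * (w ⬝ᵥ g / W) - 8 * (η * B) ^ 2) - η * (g ⬝ᵥ u) := by
          have hgu : η * (g ⬝ᵥ u) = ∑ k, η * (g k * u k) := mul_sum _ _ _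
          rw [sum_mul, hgu, ← sum_sub_distrib]
          exact sum_congr rfl fun k _ => by ring
      _ = _ := by
          rw [huW, dotProduct_sub, dotProduct_comm w]
          field_simp
          ring
  simp only [mul_sub, sum_sub_distrib] at hlog hlhs ⊢
  linarith

lemma sum_mul_log_le (hw : w ∈ openSimplex ι W) (hu : ∀ k, 0 ≤ u k) (huW : ∑ k, u k = W) :
    ∑ k, u k * log (w k) ≤ W * log W := by
  have hle (k : ι) : w k ≤ W :=
    (single_le_sum (fun k _ => (hw.1 k).le) (mem_univ k)).trans_eq hw.2
  calc ∑ k, u k * log (w k) ≤ ∑ k, u k * log W :=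
        sum_le_sum fun k _ => mul_le_mul_of_nonneg_left (log_le_log (hw.1 k) (hle k)) (hu k)
    _ = W * log W := by rw [← sum_mul, huW]

variable [Nonempty ι]

lemma const_mem_openSimplex (hW : 0 < W) :
    (fun _ => W / Fintype.card ι) ∈ openSimplex ι W := by
  refine ⟨fun _ => by positivity, ?_⟩
  rw [sum_const, card_univ, nsmul_eq_mul]
  field_simp

lemma sum_dotProduct_sub_le (hη : 0 < η) (hW : 0 < W) (hηB : 4 * (η * B) ≤ 1) {T : ℕ}
    {w : ℕ → ι → ℝ} {g : Fin T → ι → ℝ} (h0 : ∀ k, w 0 k = W / Fintype.card ι)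
    (hstep : ∀ t : Fin T, w (t + 1) = simplexStep η W (w t) (g t))
    (hw : ∀ t, w t ∈ openSimplex ι W) (hg : ∀ t k, |g t k| ≤ B) (hu : ∀ k, 0 ≤ u k)
    (huW : ∑ k, u k = W) :
    ∑ t : Fin T, g t ⬝ᵥ (w t - u)
      ≤ W * log (Fintype.card ι) / η + 8 * η * B ^ 2 * W * T := by
  have hsum : η * ∑ t : Fin T, g t ⬝ᵥ (w t - u)
      ≤ ∑ k, u k * log (w T k) - ∑ k, u k * log (w 0 k) + T * (8 * (η * B) ^ 2 * W) := by
    rw [← sum_range_sub (fun t => ∑ k, u k * log (w t k)), sum_range, mul_sum]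
    refine (sum_le_sum fun (t : Fin T) _ =>
      mul_dotProduct_sub_le hη.le hW hηB (hw t) (hg t) hu huW).trans_eq ?_
    rw [sum_add_distrib, sum_const, card_univ, Fintype.card_fin, nsmul_eq_mul]
    simp only [hstep]
  have hfinal := sum_mul_log_le (hw T) hu huW
  have hinit : ∑ k, u k * log (w 0 k) = W * (log W - log (Fintype.card ι)) := by
    simp only [h0]
    rw [← sum_mul, huW, log_div hW.ne' (by positivity)]
  refine le_of_mul_le_mul_left ?_ hη
  calc η * ∑ t : Fin T, g t ⬝ᵥ (w t - u)
      ≤ W * log (Fintype.card ι) + T * (8 * (η * B) ^ 2 * W) := by linarith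
    _ = η * (W * log (Fintype.card ι) / η + 8 * η * B ^ 2 * W * T) := by
        field_simp

end MultiplicativeDescent

section StochasticDescent

/-- The trajectory of stochastic multiplicative gradient descent on the simplex of radius `W` for
the gradient estimator `G` and the samples `X`, started at the barycenter. -/
noncomputable def descent {ι Ω : Type*} [Fintype ι] (G : (ι → ℝ) → Ω → ι → ℝ) (η W : ℝ) {T : ℕ}
    (X : Fin T → Ω) : ℕ → ι → ℝ :=
  run (fun w x => simplexStep η W w (G w x)) (fun _ => W / Fintype.card ι) X

variable {ι Ω : Type*} [Fintype ι] {G : (ι → ℝ) → Ω → ι → ℝ} {ok : Set Ω} {η W B : ℝ} {u : ι → ℝ}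

section Deterministic

variable [Nonempty ι]

lemma descent_mem (hη : 0 ≤ η) (hW : 0 < W) (hηB : 4 * (η * B) ≤ 1)
    (hG : ∀ w ∈ openSimplex ι W, ∀ x ∈ ok, ∀ k, |G w x k| ≤ B) {T : ℕ} {X : Fin T → Ω}
    (hX : ∀ t, X t ∈ ok) (t : ℕ) : descent G η W X t ∈ openSimplex ι W :=
  run_mem (fun w hw x hx => simplexStep_mem hη hW hηB hw (hG w hw x hx))
    (const_mem_openSimplex hW) hX t

lemma descent_regret_le (hη : 0 < η) (hW : 0 < W) (hηB : 4 * (η * B) ≤ 1)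
    (hG : ∀ w ∈ openSimplex ι W, ∀ x ∈ ok, ∀ k, |G w x k| ≤ B) (hu : ∀ k, 0 ≤ u k)
    (huW : ∑ k, u k = W) {T : ℕ} {X : Fin T → Ω} (hX : ∀ t, X t ∈ ok) :
    ∑ t : Fin T, G (descent G η W X t) (X t) ⬝ᵥ (descent G η W X t - u)
      ≤ W * log (Fintype.card ι) / η + 8 * η * B ^ 2 * W * T := by
  have hmem := descent_mem hη.le hW hηB hG hX
  exact sum_dotProduct_sub_le hη hW hηB (fun _ => rfl)
    (fun t => by simp only [descent, run, dif_pos t.isLt])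
    hmem (fun t => hG _ (hmem t) _ (hX t)) hu huW

end Deterministic

variable [MeasurableSpace Ω] {μ : Measure Ω} [IsProbabilityMeasure μ]

lemma ae_pi_mem (hok : ∀ᵐ x ∂μ, x ∈ ok) (T : ℕ) :
    ∀ᵐ X ∂(Measure.pi fun _ : Fin T => μ), ∀ t, X t ∈ ok :=
  ae_all_iff.2 fun t => (Measure.tendsto_eval_ae_ae (i := t)).eventually hok

lemma one_sub_le_measureReal_of_ae {s bad : Set Ω} {δ : ℝ} (hmeas : MeasurableSet bad)
    (hbad : μ.real bad ≤ δ) (hs : ∀ᵐ x ∂μ, x ∉ bad → x ∈ s) : 1 - δ ≤ μ.real s := by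
  have hcompl := probReal_compl_eq_one_sub (μ := μ) hmeas
  have hmono : μ.real badᶜ ≤ μ.real s :=
    ENNReal.toReal_mono (measure_ne_top _ _) (measure_mono_ae hs)
  linarith

variable [Countable Ω] [MeasurableSingletonClass Ω]

lemma hasSubgaussianMGF_integral_dotProduct_sub (hok : ∀ᵐ x ∂μ, x ∈ ok) {w : ι → ℝ}
    (hw : w ∈ openSimplex ι W) (hG : ∀ x ∈ ok, ∀ k, |G w x k| ≤ B) (hu : ∀ k, 0 ≤ u k)
    (huW : ∑ k, u k = W) :
    HasSubgaussianMGF (fun x => (∫ y, G w y ⬝ᵥ (w - u) ∂μ) - G w x ⬝ᵥ (w - u))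
      (‖2 * (W * B)‖₊ ^ 2) μ := by
  have hmem : ∀ᵐ x ∂μ, G w x ⬝ᵥ (w - u) ∈ Set.Icc (-(2 * (W * B))) (2 * (W * B)) := by
    filter_upwards [hok] with x hx
    exact abs_le.1 (abs_dotProduct_sub_le_of_nonneg hw hu huW (hG x hx))
  have hwidth : ‖2 * (W * B) - -(2 * (W * B))‖₊ / 2 = ‖2 * (W * B)‖₊ := by
    rw [sub_neg_eq_add, ← two_mul, nnnorm_mul, Real.nnnorm_ofNat]
    simp
  rw [← hwidth]
  exact (hasSubgaussianMGF_of_mem_Icc Measurable.of_discrete.aemeasurable hmem).neg.congr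
    (ae_of_all _ fun _ => neg_sub _ _)

variable [Nonempty ι]

lemma measureReal_deviation_le (hη : 0 ≤ η) (hW : 0 < W) (hB : 0 < B) (hηB : 4 * (η * B) ≤ 1)
    (hok : ∀ᵐ x ∂μ, x ∈ ok) (hG : ∀ w ∈ openSimplex ι W, ∀ x ∈ ok, ∀ k, |G w x k| ≤ B)
    (hu : ∀ k, 0 ≤ u k) (huW : ∑ k, u k = W) {T : ℕ} (hT : 0 < T) {l : ℝ} (hl : 0 ≤ l) :
    (Measure.pi fun _ : Fin T => μ).real {X | 3 * (W * B) * √(T * l) ≤ ∑ t : Fin T,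
        ((∫ y, G (descent G η W X t) y ⬝ᵥ (descent G η W X t - u) ∂μ)
          - G (descent G η W X t) (X t) ⬝ᵥ (descent G η W X t - u))}
      ≤ exp (-l) := by
  have hsub := hasSubgaussianMGF_sum_run (μ := μ) (good := openSimplex ι W)
    (F := fun w x => simplexStep η W w (G w x))
    (fun w hw => hok.mono fun x hx => simplexStep_mem hη hW hηB hw (hG w hw x hx))
    (fun w hw => hasSubgaussianMGF_integral_dotProduct_sub hok hw (hG w hw) hu huW) T
    (const_mem_openSimplex hW)
  refine (hsub.measure_ge_le (by positivity)).trans (exp_le_exp.2 ?_)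
  have hsq : (3 * (W * B) * √(T * l)) ^ 2 = 9 * (W * B) ^ 2 * (T * l) := by
    rw [mul_pow, sq_sqrt (by positivity)]
    ring
  push_cast
  rw [hsq, Real.norm_eq_abs, sq_abs, div_le_iff₀ (by positivity)]
  nlinarith [show 0 ≤ (W * B) ^ 2 * (T * l) by positivity]

theorem one_sub_exp_neg_le_measureReal_sum_integral_le (hη : 0 < η) (hW : 0 < W) (hB : 0 < B)
    (hηB : 4 * (η * B) ≤ 1) (hok : ∀ᵐ x ∂μ, x ∈ ok)
    (hG : ∀ w ∈ openSimplex ι W, ∀ x ∈ ok, ∀ k, |G w x k| ≤ B) (hu : ∀ k, 0 ≤ u k)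
    (huW : ∑ k, u k = W) {T : ℕ} (hT : 0 < T) {l : ℝ} (hl : 0 ≤ l) :
    1 - exp (-l) ≤ (Measure.pi fun _ : Fin T => μ).real {X |
      ∑ t : Fin T, ∫ y, G (descent G η W X t) y ⬝ᵥ (descent G η W X t - u) ∂μ
        ≤ W * log (Fintype.card ι) / η + 8 * η * B ^ 2 * W * T + 3 * (W * B) * √(T * l)} := by
  refine one_sub_le_measureReal_of_ae MeasurableSet.of_discrete
    (measureReal_deviation_le hη.le hW hB hηB hok hG hu huW hT hl) ?_
  filter_upwards [ae_pi_mem hok T] with X hX hdev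
  rw [not_le, sum_sub_distrib] at hdev
  linarith [descent_regret_le hη hW hηB hG hu huW hX]

end StochasticDescent

section Algorithm

variable {n : ℕ} {A : Matrix (Fin n) (Fin n) ℝ} {θ : Fin n → ℝ} {p : Fin n → unitInterval}
  {r : Fin n} {pmax lam η : ℝ}

lemma toBall_sub (w u : Coord n → ℝ) : toBall (w - u) = toBall w - toBall u := by
  ext i
  simp only [toBall, Pi.sub_apply]
  ring

lemma gradMiss_dotProduct (p : Fin n → unitInterval) (r : Fin n) (w u : Coord n → ℝ)
    (x : Fin n → ℤ) : gradMiss p r w x ⬝ᵥ u = gMiss p r (toBall w) x ⬝ᵥ toBall u := by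
  simp only [dotProduct, Fintype.sum_sum_type, gradMiss, toBall, mul_sub, sum_sub_distrib,
    neg_mul, sum_neg_distrib, zero_mul, sum_const_zero, add_zero]
  ring

lemma integrable_missLaw (f : (Fin n → ℤ) → ℝ) : Integrable f (missLaw A θ p) :=
  (integrable_map_measure Measurable.of_discrete.aestronglyMeasurable
    Measurable.of_discrete.aemeasurable).2 .of_finite

lemma integral_gradMiss_dotProduct (hp : ∀ i, (p i : ℝ) < 1) (r : Fin n) (w u : Coord n → ℝ) :
    ∫ x, gradMiss p r w x ⬝ᵥ u ∂(missLaw A θ p)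
      = expLossGrad (isingLaw A θ) (stat r) (toBall w) ⬝ᵥ toBall u := by
  simp only [gradMiss_dotProduct]
  simp only [dotProduct]
  rw [integral_finsetSum _ fun i _ => integrable_missLaw _]
  simp only [integral_mul_const, integral_gMiss hp]

/-- A point of the simplex of radius `lam` that represents the vector `v` of the `ℓ₁` ball. The
last coordinate takes up the slack. -/
def toSimplex (lam : ℝ) (v : Fin n → ℝ) : Coord n → ℝ
  | Sum.inl i => (v i)⁺
  | Sum.inr (Sum.inl i) => (v i)⁻
  | Sum.inr (Sum.inr _) => lam - ∑ i, |v i|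

lemma toBall_toSimplex (v : Fin n → ℝ) : toBall (toSimplex lam v) = v :=
  funext fun i => posPart_sub_negPart (v i)

lemma toSimplex_mem {v : Fin n → ℝ} (hv : ∑ i, |v i| ≤ lam) : toSimplex lam v ∈ simplex n lam := by
  refine ⟨?_, ?_⟩
  · rintro (i | i | _)
    exacts [posPart_nonneg _, negPart_nonneg _, sub_nonneg.2 hv]
  · simp only [Fintype.sum_sum_type, toSimplex, univ_unique, sum_singleton, ← add_assoc,
      ← sum_add_distrib, posPart_add_negPart, add_sub_cancel]

lemma card_coord : (Fintype.card (Coord n) : ℝ) = 2 * n + 1 := by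
  simp only [Fintype.card_sum, Fintype.card_fin, Fintype.card_unit, Nat.cast_add, Nat.cast_one]
  ring

lemma smgIterate_eq_descent {T : ℕ} (p : Fin n → unitInterval) (r : Fin n) (η W : ℝ)
    (X : Fin T → Fin n → ℤ) (t : ℕ) :
    smgIterate p r η W X t = descent (gradMiss p r) η W X t := by
  have hstep (w g : Coord n → ℝ) : smgStep η W w g = simplexStep η W w g := by
    ext k
    simp only [smgStep, simplexStep, dotProduct]
    ring
  induction t with
  | zero => rw [smgIterate, descent, run, card_coord]
  | succ t ih => rw [smgIterate, ih, descent, run]; simp only [hstep]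

/-- The bound on the entries of the gradient estimator over the simplex of radius `lam`. -/
noncomputable def gradBound (pmax lam : ℝ) : ℝ := 1 / (1 - pmax) ^ 2 * exp (lam / (1 - pmax))

lemma gradBound_pos (hq : pmax < 1) : 0 < gradBound pmax lam := by
  have : 0 < 1 - pmax := sub_pos.2 hq
  unfold gradBound
  positivity

lemma openSimplex_subset_simplex : openSimplex (Coord n) lam ⊆ simplex n lam :=
  fun _ hw => ⟨fun k => (hw.1 k).le, hw.2⟩

lemma abs_gradMiss_le (r : Fin n) (hq : pmax < 1) (hp : ∀ i, (p i : ℝ) ≤ pmax) :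
    ∀ w ∈ openSimplex (Coord n) lam, ∀ x ∈ observations n, ∀ k,
      |gradMiss p r w x k| ≤ gradBound pmax lam := fun _ hw _ hx k =>
  (norm_le_pi_norm _ k).trans (norm_gradMiss_le r hq hp (openSimplex_subset_simplex hw) hx)

lemma smgIterate_mem (hq : pmax < 1) (hp : ∀ i, (p i : ℝ) ≤ pmax) (hlam : 0 < lam) (hη : 0 ≤ η)
    (hηB : 4 * (η * gradBound pmax lam) ≤ 1) {T : ℕ} {X : Fin T → Fin n → ℤ}
    (hX : ∀ t, X t ∈ observations n) (t : ℕ) : smgIterate p r η lam X t ∈ simplex n lam := by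
  rw [smgIterate_eq_descent]
  exact openSimplex_subset_simplex (descent_mem hη hlam hηB (abs_gradMiss_le r hq hp) hX t)

variable {T : ℕ} {X : Fin T → Fin n → ℤ}

lemma smgOutput_mem (hT : 0 < T) (hmem : ∀ t, smgIterate p r η lam X t ∈ simplex n lam) :
    smgOutput p r η lam X ∈ simplex n lam := by
  refine ⟨fun k => mul_nonneg (by positivity) (sum_nonneg fun t _ => (hmem t).1 k), ?_⟩
  simp only [smgOutput]
  rw [← mul_sum, sum_comm, sum_congr rfl fun t _ => (hmem t).2, sum_const, card_range,
    nsmul_eq_mul]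
  field_simp

lemma toBall_smgOutput (p : Fin n → unitInterval) (r : Fin n) (η W : ℝ)
    (X : Fin T → Fin n → ℤ) (i : Fin n) :
    toBall (smgOutput p r η W X) i
      = (∑ t : Fin T, toBall (smgIterate p r η W X t) i) / T := by
  simp only [toBall, smgOutput, sum_sub_distrib]
  rw [sum_range, sum_range]
  ring

lemma mul_sq_mean_sub_le (hT : 0 < T) (f : Fin T → ℝ) (a : ℝ) :
    (T : ℝ) * ((∑ t, f t) / T - a) ^ 2 ≤ ∑ t, (f t - a) ^ 2 := by
  have hjensen := sq_sum_le_card_mul_sum_sq (s := univ) (f := fun t => f t - a)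
  rw [sum_sub_distrib, sum_const, card_univ, Fintype.card_fin, nsmul_eq_mul] at hjensen
  have hsq : (T : ℝ) * ((∑ t, f t) / T - a) ^ 2 = (∑ t, f t - T * a) ^ 2 / T := by
    field_simp
  rw [hsq, div_le_iff₀' (by positivity)]
  exact hjensen

lemma mul_sq_sub_le_expLossGrad_dotProduct (hA : A.IsSymm) (hd : ∀ i, A i i = 0)
    (hw : width A θ ≤ lam) {v : Fin n → ℝ} (hv : ∑ i, |v i| ≤ lam) {i : Fin n} (hi : i ≠ r) :
    exp (-3 * lam) / (2 * (1 + lam)) * (v i - A r i) ^ 2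
      ≤ expLossGrad (isingLaw A θ) (stat r) v ⬝ᵥ (v - truth A θ r) := by
  have hstrong := sq_sub_le_iso_sub_sub_grad hA hd hw hv hi
  rw [expLossGrad_truth hA hd, zero_dotProduct, sub_zero, iso_eq_expLoss] at hstrong
  have hconvex := expLossGrad_dotProduct_le (μ := isingLaw A θ) (s := stat r) (truth A θ r) v
  rw [← neg_sub v, dotProduct_neg] at hconvex
  linarith

lemma mul_sq_smgOutput_sub_le (hA : A.IsSymm) (hd : ∀ i, A i i = 0) (hw : width A θ ≤ lam)
    (hp : ∀ i, (p i : ℝ) < 1) (hT : 0 < T)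
    (hmem : ∀ t, smgIterate p r η lam X t ∈ simplex n lam) {i : Fin n} (hi : i ≠ r) :
    exp (-3 * lam) / (2 * (1 + lam)) * (T * (toBall (smgOutput p r η lam X) i - A r i) ^ 2)
      ≤ ∑ t : Fin T, ∫ x, gradMiss p r (smgIterate p r η lam X t) x
          ⬝ᵥ (smgIterate p r η lam X t - toSimplex lam (truth A θ r)) ∂(missLaw A θ p) := by
  have hlam : 0 ≤ lam := (width_nonneg r).trans hw
  simp only [integral_gradMiss_dotProduct hp, toBall_sub, toBall_toSimplex, toBall_smgOutput]
  refine (mul_le_mul_of_nonneg_left (mul_sq_mean_sub_le hT _ _) (by positivity)).trans ?_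
  rw [mul_sum]
  exact sum_le_sum fun t _ =>
    mul_sq_sub_le_expLossGrad_dotProduct hA hd hw (sum_abs_toBall_le (hmem t)) hi

theorem one_sub_exp_neg_le_measureReal_sq_smgOutput_sub_le (hA : A.IsSymm) (hd : ∀ i, A i i = 0)
    (hw : width A θ ≤ lam) (hq : pmax < 1) (hp : ∀ i, (p i : ℝ) ≤ pmax) (hlam : 0 < lam)
    (hη : 0 < η) (hηB : 4 * (η * gradBound pmax lam) ≤ 1) (hT : 0 < T) {l : ℝ} (hl : 0 ≤ l) :
    1 - exp (-l) ≤ (Measure.pi fun _ : Fin T => missLaw A θ p).real {X | ∀ i, i ≠ r →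
      exp (-3 * lam) / (2 * (1 + lam)) * (T * (toBall (smgOutput p r η lam X) i - A r i) ^ 2)
        ≤ lam * log (2 * n + 1) / η + 8 * η * gradBound pmax lam ^ 2 * lam * T
          + 3 * (lam * gradBound pmax lam) * √(T * l)} := by
  have hu := toSimplex_mem ((sum_abs_truth_le_width hd r).trans hw)
  have hae := ae_missLaw_mem_observations (A := A) (θ := θ) p
  refine (one_sub_exp_neg_le_measureReal_sum_integral_le hη hlam (gradBound_pos hq) hηB hae
    (abs_gradMiss_le r hq hp) hu.1 hu.2 hT hl).trans
      (ENNReal.toReal_mono (measure_ne_top _ _) (measure_mono_ae ?_))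
  filter_upwards [ae_pi_mem hae T] with X hX hsum i hi
  refine (mul_sq_smgOutput_sub_le hA hd hw (fun i => (hp i).trans_lt hq) hT
    (smgIterate_mem hq hp hlam hη.le hηB hX) hi).trans ?_
  simp only [smgIterate_eq_descent, ← card_coord]
  exact hsum

lemma ae_abs_smgOutput_sub_le (hd : ∀ i, A i i = 0) (hw : width A θ ≤ lam) (hq : pmax < 1)
    (hp : ∀ i, (p i : ℝ) ≤ pmax) (hlam : 0 < lam) (hη : 0 ≤ η)
    (hηB : 4 * (η * gradBound pmax lam) ≤ 1) (hT : 0 < T) :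
    ∀ᵐ X ∂(Measure.pi fun _ : Fin T => missLaw A θ p), ∀ i, i ≠ r →
      |toBall (smgOutput p r η lam X) i - A r i| ≤ 2 * lam := by
  filter_upwards [ae_pi_mem (ae_missLaw_mem_observations p) T] with X hX i hi
  have hcoord {v : Fin n → ℝ} (hv : ∑ j, |v j| ≤ lam) : |v i| ≤ lam :=
    (single_le_sum (fun j _ => abs_nonneg (v j)) (mem_univ i)).trans hv
  have htruth := hcoord ((sum_abs_truth_le_width hd r).trans hw)
  have houtput := hcoord
    (sum_abs_toBall_le (smgOutput_mem hT (smgIterate_mem (r := r) hq hp hlam hη hηB hX)))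
  rw [truth, if_neg hi] at htruth
  linarith [abs_sub (toBall (smgOutput p r η lam X) i) (A r i)]

end Algorithm

section SampleComplexity

/-- The step size for `T` steps with gradient estimates bounded by `B`, where `L` is the logarithm
of the number of coordinates. It is of the optimal order `√(L / T) / B` when `L ≤ T`; the extra `L`
in the denominator keeps it at most `1 / (4 * B)`, and positive at `T = 0`. -/
noncomputable def stepSize (L B T : ℝ) : ℝ := √(L / (L + T)) / (4 * B)

variable {L B T W l : ℝ}

lemma stepSize_pos (hL : 0 < L) (hB : 0 < B) (hT : 0 ≤ T) : 0 < stepSize L B T := by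
  unfold stepSize
  positivity

lemma four_mul_stepSize_mul_le (hL : 0 ≤ L) (hB : 0 < B) (hT : 0 ≤ T) :
    4 * (stepSize L B T * B) ≤ 1 := by
  have hmul : 4 * (stepSize L B T * B) = √(L / (L + T)) := by
    unfold stepSize
    field_simp
  rw [hmul, sqrt_le_one]
  exact div_le_one_of_le₀ (by linarith) (by linarith)

lemma regret_stepSize_le (hL : 0 < L) (hB : 0 < B) (hW : 0 ≤ W) (hLT : L ≤ T) (hLl : L ≤ 3 * l) :
    W * L / stepSize L B T + 8 * stepSize L B T * B ^ 2 * W * T + 3 * (W * B) * √(T * l)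
      ≤ 23 * (W * B) * √(T * l) := by
  have hT : 0 < T := hL.trans_le hLT
  unfold stepSize
  set y := √(L / (L + T)) with hy
  have hy0 : 0 < y := by positivity
  have hy2 : y ^ 2 * (L + T) = L := by
    rw [hy, sq_sqrt (by positivity)]
    field_simp
  have hterms : W * L / (y / (4 * B)) + 8 * (y / (4 * B)) * B ^ 2 * W * T
      = 4 * (W * B) * (y * (L + T)) + 2 * (W * B) * (y * T) := by
    have hL' : L / y = y * (L + T) := by
      rw [div_eq_iff hy0.ne']
      linarith
    rw [← hL']
    field_simp
    ring
  have hyT : y * T ≤ 2 * √(T * l) := by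
    refine le_of_sq_le_sq ?_ (by positivity)
    rw [mul_pow, mul_pow, sq_sqrt (mul_nonneg hT.le (by linarith))]
    nlinarith [mul_pos (pow_pos hy0 2) hL]
  have hyL : y * (L + T) ≤ 4 * √(T * l) := by nlinarith
  have hWB : 0 ≤ W * B := by positivity
  rw [hterms]
  nlinarith

lemma log_two_mul_add_one_le {n : ℕ} (hn : 2 ≤ n) {δ : ℝ} (hδ : 0 < δ) (hδ1 : δ < 1) :
    log (2 * n + 1) ≤ 3 * log (n / δ) := by
  have hn' : (2 : ℝ) ≤ n := by exact_mod_cast hn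
  calc log (2 * n + 1) ≤ log ((n : ℝ) ^ 3) :=
        log_le_log (by positivity) (by nlinarith [sq_nonneg ((n : ℝ) - 2)])
    _ = 3 * log n := by rw [log_pow, Nat.cast_ofNat]
    _ ≤ 3 * log (n / δ) := by
        gcongr
        exact le_div_self (by positivity) hδ hδ1.le

variable {pmax lam₀ lam : ℝ}

/-- The constant `C` in the exponent of the sample complexity. The last summand absorbs the factor
`46 * (1 + 1 / lam₀) / (1 - pmax) ^ 2` by means of `1 + x ≤ exp x`. -/
noncomputable def rateConst (pmax lam₀ : ℝ) : ℝ :=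
  2 * (3 + 1 / (1 - pmax) + 46 * (1 + 1 / lam₀) / (1 - pmax) ^ 2 / lam₀)

lemma rateConst_pos (hq : pmax < 1) (h0 : 0 < lam₀) : 0 < rateConst pmax lam₀ := by
  have : 0 < 1 - pmax := sub_pos.2 hq
  unfold rateConst
  positivity

lemma exp_rateConst_mul (pmax lam₀ lam : ℝ) :
    exp (rateConst pmax lam₀ * lam) = exp (rateConst pmax lam₀ / 2 * lam) ^ 2 := by
  rw [← exp_nat_mul, Nat.cast_ofNat]
  ring_nf

lemma le_exp_rateConst_div_two_mul (hq : pmax < 1) (h0 : 0 < lam₀) (hlam : lam₀ ≤ lam) :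
    46 * (1 + 1 / lam₀) / (1 - pmax) ^ 2 * exp (3 * lam + lam / (1 - pmax))
      ≤ exp (rateConst pmax lam₀ / 2 * lam) := by
  have hq' : 0 < 1 - pmax := sub_pos.2 hq
  unfold rateConst
  set K := 46 * (1 + 1 / lam₀) / (1 - pmax) ^ 2
  have hK0 : 0 < K := by positivity
  have hsplit : 2 * (3 + 1 / (1 - pmax) + K / lam₀) / 2 * lam
      = K * (lam / lam₀) + (3 * lam + lam / (1 - pmax)) := by
    field_simp
    ring
  rw [hsplit, exp_add (K * (lam / lam₀))]
  gcongr
  calc K ≤ K * (lam / lam₀) := le_mul_of_one_le_right hK0.le ((one_le_div h0).2 hlam)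
    _ ≤ exp (K * (lam / lam₀)) := by linarith [add_one_le_exp (K * (lam / lam₀))]

lemma gradBound_le_rate (hq : pmax < 1) (h0 : 0 < lam₀) (hlam : lam₀ ≤ lam) :
    23 * gradBound pmax lam
      ≤ exp (-3 * lam) / (2 * (1 + lam)) * lam * exp (rateConst pmax lam₀ / 2 * lam) := by
  have hlam0 : 0 < lam := h0.trans_le hlam
  have hq' : 0 < 1 - pmax := sub_pos.2 hq
  have hratio : 1 ≤ lam * (1 + 1 / lam₀) / (1 + lam) := by
    rw [one_le_div (by positivity), mul_add, mul_one, mul_one_div, add_comm]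
    gcongr
    exact (one_le_div h0).2 hlam
  have hexp : exp (-3 * lam) * exp (3 * lam + lam / (1 - pmax)) = exp (lam / (1 - pmax)) := by
    rw [← exp_add]
    ring_nf
  calc 23 * gradBound pmax lam
      ≤ 23 * gradBound pmax lam * (lam * (1 + 1 / lam₀) / (1 + lam)) :=
        le_mul_of_one_le_right (by linarith [gradBound_pos (lam := lam) hq]) hratio
    _ = exp (-3 * lam) / (2 * (1 + lam)) * lam
          * (46 * (1 + 1 / lam₀) / (1 - pmax) ^ 2 * exp (3 * lam + lam / (1 - pmax))) := by
        rw [gradBound, ← hexp]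
        field_simp
        ring
    _ ≤ _ := by
        gcongr
        exact le_exp_rateConst_div_two_mul hq h0 hlam

lemma forty_six_le_exp_rateConst_div_two_mul (hq0 : 0 ≤ pmax) (hq : pmax < 1) (h0 : 0 < lam₀)
    (hlam : lam₀ ≤ lam) : 46 ≤ exp (rateConst pmax lam₀ / 2 * lam) := by
  have hlam0 : 0 < lam := h0.trans_le hlam
  have hq' : 0 < 1 - pmax := sub_pos.2 hq
  have hcoeff : 46 ≤ 46 * (1 + 1 / lam₀) / (1 - pmax) ^ 2 := by
    rw [mul_div_assoc]
    refine le_mul_of_one_le_right (by norm_num) ((one_le_div (by positivity)).2 ?_)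
    exact (pow_le_one₀ hq'.le (by linarith)).trans (le_add_of_nonneg_right (by positivity))
  refine hcoeff.trans (le_trans ?_ (le_exp_rateConst_div_two_mul hq h0 hlam))
  exact le_mul_of_one_le_right (by linarith) (one_le_exp (by positivity))

variable {κ D ε : ℝ}

lemma three_mul_le_of_sampleSize_le (hW : 0 < W) (hD : 46 ≤ D) (hl : 0 ≤ l) (hT : 0 ≤ T)
    (hε : 0 ≤ ε) (hεW : ε ≤ 2 * W) (hTε : W ^ 4 * l * D ^ 2 ≤ T * ε ^ 4) : 3 * l ≤ T := by
  have hε4 : T * ε ^ 4 ≤ T * (2 * W) ^ 4 := by gcongr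
  have hD2 : 48 ≤ D ^ 2 := by nlinarith
  have hlD : l * D ^ 2 ≤ 16 * T :=
    le_of_mul_le_mul_left (a := W ^ 4) (by linarith) (by positivity)
  nlinarith

lemma abs_le_of_mul_sq_le (hκ : 0 < κ) (hW : 0 < W) (hT : 0 < T) (hl : 0 ≤ l)
    (hε : 0 ≤ ε) (hrate : 23 * B ≤ κ * W * D) (hTε : W ^ 4 * l * D ^ 2 ≤ T * ε ^ 4) {e : ℝ}
    (he : κ * (T * e ^ 2) ≤ 23 * (W * B) * √(T * l)) : |e| ≤ ε := by
  have hsqrt : W ^ 2 * D * √(T * l) ≤ T * ε ^ 2 := by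
    refine le_of_sq_le_sq ?_ (by positivity)
    rw [mul_pow, sq_sqrt (by positivity)]
    nlinarith
  have hκe : κ * (T * e ^ 2) ≤ κ * (T * ε ^ 2) :=
    calc κ * (T * e ^ 2) ≤ (23 * B) * (W * √(T * l)) := by linarith
      _ ≤ (κ * W * D) * (W * √(T * l)) := by gcongr
      _ = κ * (W ^ 2 * D * √(T * l)) := by ring
      _ ≤ κ * (T * ε ^ 2) := by gcongr
  exact abs_le_of_sq_le_sq (le_of_mul_le_mul_left (le_of_mul_le_mul_left hκe hκ) hT) hε

end SampleComplexity

section Recovery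

variable {n : ℕ} {A : Matrix (Fin n) (Fin n) ℝ} {θ : Fin n → ℝ} {p : Fin n → unitInterval}
  {pmax lam₀ lam ε δ : ℝ} {T : ℕ}

lemma recovery_of_le_two_mul (hq : pmax < 1) (h0 : 0 < lam₀) (r : Fin n)
    (hp : ∀ i, (p i : ℝ) ≤ pmax) (hlam : lam₀ ≤ lam) (hA : A.IsSymm) (hd : ∀ i, A i i = 0)
    (hw : width A θ ≤ lam) (hn : 2 ≤ n) (hε : 0 < ε) (hεlam : ε ≤ 2 * lam) (hδ : 0 < δ)
    (hδ1 : δ < 1) (hT : 0 < T)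
    (hTε : lam ^ 4 * log (n / δ) * exp (rateConst pmax lam₀ / 2 * lam) ^ 2 ≤ T * ε ^ 4) :
    1 - δ ≤ (Measure.pi fun _ : Fin T => missLaw A θ p).real {X | ∀ i, i ≠ r →
      |toBall (smgOutput p r (stepSize (log (2 * n + 1)) (gradBound pmax lam) T) lam X) i
        - A r i| ≤ ε} := by
  have hlam0 : 0 < lam := h0.trans_le hlam
  have hB : 0 < gradBound pmax lam := gradBound_pos hq
  have hn1 : (1 : ℝ) ≤ n := by exact_mod_cast one_le_two.trans hn
  have hL : 0 < log (2 * n + 1) := log_pos (by linarith)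
  have hl : 0 ≤ log (n / δ) := log_nonneg ((one_le_div hδ).2 (hδ1.le.trans hn1))
  have hLl := log_two_mul_add_one_le hn hδ hδ1
  have hLT : log (2 * n + 1) ≤ T := hLl.trans <| three_mul_le_of_sampleSize_le hlam0
    (forty_six_le_exp_rateConst_div_two_mul ((p r).2.1.trans (hp r)) hq h0 hlam) hl
    T.cast_nonneg hε.le hεlam hTε
  have hexp : exp (-log (n / δ)) ≤ δ := by
    rw [exp_neg, exp_log (by positivity), inv_div]
    exact div_le_self hδ.le hn1
  refine (sub_le_sub_left hexp 1).trans <|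
    (one_sub_exp_neg_le_measureReal_sq_smgOutput_sub_le (r := r) hA hd hw hq hp hlam0
      (stepSize_pos hL hB T.cast_nonneg) (four_mul_stepSize_mul_le hL.le hB T.cast_nonneg) hT
      hl).trans (measureReal_mono fun X hX i hi => ?_)
  exact abs_le_of_mul_sq_le (by positivity) hlam0 (Nat.cast_pos.2 hT) hl hε.le
    (gradBound_le_rate hq h0 hlam) hTε
    ((hX i hi).trans (regret_stepSize_le hL hB hlam0.le hLT hLl))

theorem recovery (hq : pmax < 1) (h0 : 0 < lam₀) (r : Fin n) (hp : ∀ i, (p i : ℝ) ≤ pmax)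
    (hlam : lam₀ ≤ lam) (hA : A.IsSymm) (hd : ∀ i, A i i = 0) (hw : width A θ ≤ lam)
    (hε : 0 < ε) (hδ : 0 < δ) (hδ1 : δ < 1)
    (hT : lam ^ 4 * log (n / δ) * exp (rateConst pmax lam₀ * lam) * ε⁻¹ ^ 4 ≤ T) :
    1 - δ ≤ (Measure.pi fun _ : Fin T => missLaw A θ p).real {X | ∀ i, i ≠ r →
      |toBall (smgOutput p r (stepSize (log (2 * n + 1)) (gradBound pmax lam) T) lam X) i
        - A r i| ≤ ε} := by
  have hlam0 : 0 < lam := h0.trans_le hlam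
  have hB : 0 < gradBound pmax lam := gradBound_pos hq
  have hn1 : (1 : ℝ) ≤ n := by exact_mod_cast Fin.pos r
  have hL : 0 < log (2 * n + 1) := log_pos (by linarith)
  have hl : 0 < log (n / δ) := log_pos ((one_lt_div hδ).2 (hδ1.trans_le hn1))
  have hT0 : 0 < T := Nat.cast_pos.1 (lt_of_lt_of_le (by positivity) hT)
  have of_ae {s : Set (Fin T → Fin n → ℤ)}
      (hs : ∀ᵐ X ∂(Measure.pi fun _ : Fin T => missLaw A θ p), X ∈ s) :
      1 - δ ≤ (Measure.pi fun _ : Fin T => missLaw A θ p).real s :=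
    one_sub_le_measureReal_of_ae .empty (by simpa using hδ.le) (hs.mono fun _ hX _ => hX)
  rcases le_total (2 * lam) ε with hεlam | hεlam
  · exact of_ae <| (ae_abs_smgOutput_sub_le hd hw hq hp hlam0
      (stepSize_pos hL hB T.cast_nonneg).le (four_mul_stepSize_mul_le hL.le hB T.cast_nonneg)
      hT0).mono fun X hX i hi => (hX i hi).trans hεlam
  rcases subsingleton_or_nontrivial (Fin n) with hsub | hnontrivial
  · exact of_ae (ae_of_all _ fun X i hi => absurd (Subsingleton.elim i r) hi)
  rw [inv_pow, ← div_eq_mul_inv, div_le_iff₀ (by positivity), exp_rateConst_mul] at hT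
  exact recovery_of_le_two_mul hq h0 r hp hlam hA hd hw (Fin.nontrivial_iff_two_le.1 hnontrivial)
    hε hεlam hδ hδ1 hT0 hT

end Recovery

end MissingIsing

theorem mainTheorem3 :
    -- restricted strong convexity of the modified objective in the non-field coordinates
    (∀ (n : ℕ) (A : Matrix (Fin n) (Fin n) ℝ) (θ : Fin n → ℝ) (r : Fin n) (lam : ℝ),
      A.IsSymm → (∀ i, A i i = 0) → MissingIsing.width A θ ≤ lam →
      ∀ v : Fin n → ℝ, ∑ i, |v i| ≤ lam →
        MissingIsing.iso A θ r v - MissingIsing.iso A θ r (MissingIsing.truth A θ r) ≥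
          fderiv ℝ (MissingIsing.iso A θ r) (MissingIsing.truth A θ r)
              (v - MissingIsing.truth A θ r)
            + Real.exp (-3 * lam) / (2 * (1 + lam))
              * ‖fun i : {i : Fin n // i ≠ r} => v i - A r i‖ ^ 2) ∧
    -- the gradient estimator is unbiased, and bounded on the simplex
    (∀ (n : ℕ) (A : Matrix (Fin n) (Fin n) ℝ) (θ : Fin n → ℝ) (r : Fin n)
      (p : Fin n → unitInterval) (pmax lam : ℝ),
      A.IsSymm → (∀ i, A i i = 0) → pmax < 1 → (∀ i, (p i : ℝ) ≤ pmax) →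
      (∀ w : MissingIsing.Coord n → ℝ,
        HasFDerivAt (fun u => MissingIsing.iso A θ r (MissingIsing.toBall u))
          (∑ k, (∫ x, MissingIsing.gradMiss p r w x k ∂(MissingIsing.missLaw A θ p)) •
            ContinuousLinearMap.proj (R := ℝ) (φ := fun _ : MissingIsing.Coord n => ℝ) k) w) ∧
      (∀ w ∈ MissingIsing.simplex n lam, ∀ x : Fin n → ℤ,
        (∀ i, x i = -1 ∨ x i = 0 ∨ x i = 1) →
        ‖MissingIsing.gradMiss p r w x‖ ≤ 1 / (1 - pmax) ^ 2 * Real.exp (lam / (1 - pmax)))) ∧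
    -- the algorithm recovers all the edge weights at the vertex `r`
    (∀ pmax < (1 : ℝ), ∀ lam₀ > (0 : ℝ), ∃ C > (0 : ℝ),
      ∀ (n : ℕ) (r : Fin n) (p : Fin n → unitInterval) (lam : ℝ) (T : ℕ),
        (∀ i, (p i : ℝ) ≤ pmax) → lam₀ ≤ lam →
        ∃ η > (0 : ℝ),
          ∀ (A : Matrix (Fin n) (Fin n) ℝ) (θ : Fin n → ℝ) (ε δ : ℝ),
            A.IsSymm → (∀ i, A i i = 0) → MissingIsing.width A θ ≤ lam →
            0 < ε → 0 < δ → δ < 1 →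
            (T : ℝ) ≥ lam ^ 4 * Real.log (n / δ) * Real.exp (C * lam) * ε⁻¹ ^ 4 →
            (MeasureTheory.Measure.pi fun _ : Fin T => MissingIsing.missLaw A θ p).real
              {X | ∀ i, i ≠ r →
                |MissingIsing.toBall (MissingIsing.smgOutput p r η lam X) i - A r i| ≤ ε}
              ≥ 1 - δ) := by
  refine ⟨fun n A θ r lam hA hd hw v hv =>
      MissingIsing.restricted_strong_convexity hA hd hw r hv,
    fun n A θ r p pmax lam _ _ hq hp =>
      ⟨MissingIsing.hasFDerivAt_iso_toBall (fun i => (hp i).trans_lt hq) r,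
        fun w hw x hx => MissingIsing.norm_gradMiss_le r hq hp hw hx⟩,
    fun pmax hq lam₀ h0 => ⟨MissingIsing.rateConst pmax lam₀, MissingIsing.rateConst_pos hq h0, ?_⟩⟩
  intro n r p lam T hp hlam
  have hn : (1 : ℝ) ≤ n := by exact_mod_cast Fin.pos r
  refine ⟨MissingIsing.stepSize (Real.log (2 * n + 1)) (MissingIsing.gradBound pmax lam) T,
    MissingIsing.stepSize_pos (Real.log_pos (by linarith)) (MissingIsing.gradBound_pos hq)
      T.cast_nonneg, ?_⟩
  intro A θ ε δ hA hd hw hε hδ hδ1 hT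
  exact MissingIsing.recovery hq h0 r hp hlam hA hd hw hε hδ hδ1 hT
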